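/- Let $W$ be a space-time white noise on $(0,\infty)\times\mathbb{R}$, that is, the isonormal Gaussian process over $L^2((0,\infty)\times\mathbb{R})$ (a centered Gaussian family with $\mathrm{E}[W(h)W(g)]=\int_0^\infty\!\int_{\mathbb{R}} h\,g\,\mathrm{d}y\,\mathrm{d}s$; one writes $W(h)=\int h(s,y)\,W(\mathrm{d}s\,\mathrm{d}y)$), and let $G_s(y)=(4\pi s)^{-1/2}\exp(-y^2/(4s))$ for $s>0$, $y\in\mathbb{R}$. For $\alpha\in(0,1)$, $t>0$ and $x\in\mathbb{R}$ consider the Wiener integrals \[ H(t,x)=\int_{(0,t)\times\mathbb{R}}G_{t-s}(y-x)\,W(\mathrm{d}s\,\mathrm{d}y),\qquad H_\alpha(t,x)=\int_{(0,t)\times[x-t^{(1-\alpha)/2},\,x+t^{(1-\alpha)/2}]}G_{t-s}(y-x)\,W(\mathrm{d}s\,\mathrm{d}y). \] Thus $H$ solves $\partial_tH=\partial_x^2H+\dot W$ with $H(0)=0$, and $H_\alpha$ is its spatially localized version. Fix $\alpha\in(0,1)$ and $R>0$. Then both random fields have versions that are almost surely continuous on $(0,\infty)\times\mathbb{R}$,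 and for any such versions, almost surely, \[ \sup_{x\in[-R,R]}\left|H(t,x)-H_\alpha(t,x)\right|=o(t^{1/4})\qquad\text{as }t\to0^+. \] -/

import Mathlib

open MeasureTheory ProbabilityTheory Set Filter Topology Asymptotics

namespace LocalizedHeat

noncomputable section

/-- Lebesgue measure on the space-time half plane `(0, ∞) × ℝ`; points are pairs `(s, y)`
with `s` the time and `y` the space coordinate. -/
def spaceTime : Measure (ℝ × ℝ) := volume.restrict (Ioi 0 ×ˢ univ)

/-- The Hilbert space `L²((0, ∞) × ℝ)`. -/
abbrev L2 : Type := Lp ℝ 2 spaceTime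

/-- Space-time white noise on `(0, ∞) × ℝ`, as the isonormal Gaussian process on
`L²((0, ∞) × ℝ)`: a centered Gaussian family with `E[W(h) W(g)] = ⟪h, g⟫`. The variable `W h` is
the Wiener integral `∫ h(s, y) W(ds dy)`, and `W(A)` is the value at the indicator of `A`. -/
structure IsWhiteNoise {Ω : Type*} [MeasurableSpace Ω] (W : L2 → Ω → ℝ) (P : Measure Ω) :
    Prop where
  gaussian : IsGaussianProcess W P
  centered : ∀ h : L2, ∫ ω, W h ω ∂P = 0
  covariance : ∀ h g : L2, ∫ ω, W h ω * W g ω ∂P = inner ℝ h g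

/-- The heat kernel `G_s(y) = (4 π s)^(-1/2) exp(-y² / (4 s))` of `∂ₜ = ∂ₓ²`. -/
def heatKernel (s y : ℝ) : ℝ := (4 * Real.pi * s) ^ (-(1 / 2) : ℝ) * Real.exp (-y ^ 2 / (4 * s))

/-- `(s, y) ↦ 1_{(0, t)}(s) G_{t-s}(y - x)`. -/
def integrand (t x : ℝ) : ℝ × ℝ → ℝ :=
  (Ioo 0 t ×ˢ univ).indicator fun p => heatKernel (t - p.1) (p.2 - x)

/-- The window `[x - t^((1-α)/2), x + t^((1-α)/2)]`. -/
def window (α t x : ℝ) : Set ℝ :=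
  Icc (x - t ^ ((1 - α) / 2)) (x + t ^ ((1 - α) / 2))

/-- `(s, y) ↦ 1_{(0, t)}(s) 1_{window}(y) G_{t-s}(y - x)`. -/
def localIntegrand (α t x : ℝ) : ℝ × ℝ → ℝ :=
  (Ioo 0 t ×ˢ window α t x).indicator fun p => heatKernel (t - p.1) (p.2 - x)

theorem measurable_integrand (t x : ℝ) : Measurable (integrand t x) := by
  unfold integrand heatKernel
  refine Measurable.indicator ?_ (measurableSet_Ioo.prod MeasurableSet.univ)
  fun_prop

theorem heatKernel_eq {s : ℝ} (hs : 0 < s) (y : ℝ) :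
    heatKernel s y = gaussianPDFReal 0 (2 * s).toNNReal y := by
  have h : ((2 * s).toNNReal : ℝ) = 2 * s := Real.coe_toNNReal _ (by positivity)
  unfold heatKernel gaussianPDFReal
  rw [h, Real.rpow_neg (by positivity), ← Real.sqrt_eq_rpow]
  congr 1
  · congr 2; ring
  · rw [sub_zero]; congr 2; ring

theorem heatKernel_sq_le {s : ℝ} (hs : 0 < s) (y : ℝ) :
    heatKernel s y ^ 2 ≤ s ^ (-(1 / 2) : ℝ) * gaussianPDFReal 0 (2 * s).toNNReal y := by
  rw [← heatKernel_eq hs, sq]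
  have h0 : 0 ≤ heatKernel s y := by unfold heatKernel; positivity
  refine mul_le_mul_of_nonneg_right ?_ h0
  unfold heatKernel
  have h1 : Real.exp (-y ^ 2 / (4 * s)) ≤ 1 := by
    rw [Real.exp_le_one_iff, neg_div]
    have : 0 ≤ y ^ 2 / (4 * s) := by positivity
    linarith
  have h2 : (4 * Real.pi * s) ^ (-(1 / 2) : ℝ) ≤ s ^ (-(1 / 2) : ℝ) := by
    apply Real.rpow_le_rpow_of_nonpos hs
    · nlinarith [Real.pi_gt_three]
    · norm_num
  calc _ ≤ (4 * Real.pi * s) ^ (-(1 / 2) : ℝ) * 1 := by gcongr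
    _ ≤ _ := by rw [mul_one]; exact h2

theorem memLp_integrand (t x : ℝ) : MemLp (integrand t x) 2 spaceTime := by
  have hm := measurable_integrand t x
  rw [memLp_two_iff_integrable_sq hm.aestronglyMeasurable]
  refine Integrable.mono_measure (ν := volume) ?_ Measure.restrict_le_self
  refine ⟨(hm.pow_const 2).aestronglyMeasurable, ?_⟩
  rw [hasFiniteIntegral_iff_ofReal (Eventually.of_forall fun p => sq_nonneg _)]
  rw [Measure.volume_eq_prod, lintegral_prod _ (by fun_prop)]
  have key : ∀ s : ℝ, ∫⁻ y, ENNReal.ofReal (integrand t x (s, y) ^ 2) ≤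
      (Ioo 0 t).indicator (fun s => ENNReal.ofReal ((t - s) ^ (-(1 / 2) : ℝ))) s := by
    intro s
    by_cases hs : s ∈ Ioo 0 t
    · rw [indicator_of_mem hs]
      have hts : 0 < t - s := sub_pos.2 hs.2
      have hv : (2 * (t - s)).toNNReal ≠ 0 := by
        rw [Ne, Real.toNNReal_eq_zero, not_le]; positivity
      calc ∫⁻ y, ENNReal.ofReal (integrand t x (s, y) ^ 2)
          ≤ ∫⁻ y, ENNReal.ofReal ((t - s) ^ (-(1 / 2) : ℝ)) *
              gaussianPDF 0 (2 * (t - s)).toNNReal (y - x) := by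
            refine lintegral_mono fun y => ?_
            rw [gaussianPDF, ← ENNReal.ofReal_mul (by positivity)]
            refine ENNReal.ofReal_le_ofReal ?_
            have : integrand t x (s, y) = heatKernel (t - s) (y - x) :=
              indicator_of_mem (show (s, y) ∈ Ioo 0 t ×ˢ univ from ⟨hs, mem_univ _⟩) _
            rw [this]
            exact heatKernel_sq_le hts _
        _ = ENNReal.ofReal ((t - s) ^ (-(1 / 2) : ℝ)) := by
            rw [lintegral_const_mul _ (by fun_prop),
              lintegral_sub_right_eq_self (fun y => gaussianPDF 0 (2 * (t - s)).toNNReal y) x,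
              lintegral_gaussianPDF_eq_one _ hv, mul_one]
    · rw [indicator_of_notMem hs, nonpos_iff_eq_zero]
      have : ∀ y, integrand t x (s, y) = 0 := fun y =>
        indicator_of_notMem (fun h => hs h.1) _
      simp [this]
  refine (lintegral_mono key).trans_lt ?_
  rw [lintegral_indicator measurableSet_Ioo]
  rcases le_or_gt t 0 with ht | ht
  · simp [Ioo_eq_empty (not_lt.2 ht)]
  have h1 : IntervalIntegrable (fun s : ℝ => s ^ (-(1 / 2) : ℝ)) volume t 0 :=
    intervalIntegral.intervalIntegrable_rpow' (by norm_num)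
  have h2 := h1.comp_sub_left t
  simp only [sub_self, sub_zero] at h2
  rw [intervalIntegrable_iff_integrableOn_Ioo_of_le ht.le] at h2
  exact h2.lintegral_lt_top

theorem localIntegrand_eq (α t x : ℝ) :
    localIntegrand α t x = (univ ×ˢ window α t x).indicator (integrand t x) := by
  unfold localIntegrand integrand
  rw [indicator_indicator, prod_inter_prod, univ_inter, inter_univ]

theorem memLp_localIntegrand (α t x : ℝ) : MemLp (localIntegrand α t x) 2 spaceTime := by
  rw [localIntegrand_eq]
  exact (memLp_integrand t x).indicator (MeasurableSet.univ.prod measurableSet_Icc)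

/-- `X` is a continuous version on `(0, ∞) × ℝ` of the Wiener integrals
`(t, x) ↦ ∫ k_{t,x}(s, y) W(ds dy)`. Its values at times `t ≤ 0` are irrelevant. -/
structure IsContinuousVersion {Ω : Type*} [MeasurableSpace Ω] (P : Measure Ω) (W : L2 → Ω → ℝ)
    (k : ℝ → ℝ → L2) (X : ℝ → ℝ → Ω → ℝ) : Prop where
  ae_eq : ∀ t > 0, ∀ x : ℝ, X t x =ᵐ[P] W (k t x)
  continuous : ∀ᵐ ω ∂P, ContinuousOn (fun p : ℝ × ℝ => X p.1 p.2 ω) (Ioi 0 ×ˢ univ)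

/-- `H` is the (continuous) mild solution of `∂ₜ H = ∂ₓ² H + Ẇ`, `H(0) = 0`, that is
`H(t, x) = ∫_{(0, t) × ℝ} G_{t-s}(y - x) W(ds dy)`. -/
def IsHeatField {Ω : Type*} [MeasurableSpace Ω] (P : Measure Ω) (W : L2 → Ω → ℝ)
    (H : ℝ → ℝ → Ω → ℝ) : Prop :=
  IsContinuousVersion P W (fun t x => (memLp_integrand t x).toLp _) H

/-- `Hα` is the (continuous) localized field, that is
`Hα(t, x) = ∫_{(0, t) × [x - t^((1-α)/2), x + t^((1-α)/2)]} G_{t-s}(y - x) W(ds dy)`. -/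
def IsLocalHeatField {Ω : Type*} [MeasurableSpace Ω] (P : Measure Ω) (W : L2 → Ω → ℝ) (α : ℝ)
    (Hα : ℝ → ℝ → Ω → ℝ) : Prop :=
  IsContinuousVersion P W (fun t x => (memLp_localIntegrand α t x).toLp _) Hα

end

end LocalizedHeat

/-!
The two fields are `W` applied to the `L²` elements `heatElt t x` and `localElt α t x`, so
everything rests on estimates of these elements and on a continuity theorem.

Interpolating between sup and Lipschitz bounds of the heat kernel, with exponents for which the
singularity at `s = t` remains integrable, shows that `heatElt` is locally Hölder continuous in
`L²`, up to time `0` (`isLocallyHolder_heatElt`). Moving the window changes `localElt` further only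
over the two intervals between corresponding ends of the windows, whose lengths are Hölder
continuous in `(t, x)`; hence `localElt` is locally Hölder continuous as well
(`isLocallyHolder_localElt`). Since Gaussian variables have moments of all orders, the Kolmogorov
continuity theorem (`HasIncrementTail.exists_continuous_version`) gives a continuous version for
every Hölder exponent. It is proved by approximating a point by the lower left corners of the dyadic
squares that contain it: by
Borel–Cantelli, the increments between neighbouring grid points decay geometrically, uniformly on
boxes.

For the asymptotics, the window has half-width `t ^ ((1 - α) / 2)`, much larger than the diffusive
scale `√t`, so the Gaussian tail makes `heatElt t x - localElt α t x` smaller than any power of `t`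
(`exists_norm_heatElt_sub_localElt_sq_le`). Interpolating with the Hölder bound,
`t ^ (-1/4) • (heatElt t x - localElt α t x)` is still Hölder continuous up to `t = 0`, where it
vanishes (`IsLocallyHolder.rpow_smul`). The continuity theorem, applied to this field, yields a
continuous `Y` with `Y (0, x) = 0` such that, almost surely and for all `t > 0`, the difference of
any two continuous versions is `t ^ (1/4) * Y (t, x)`. Compactness of `[-R, R]` turns `Y (0, ·) = 0` into uniform convergence.
-/

namespace LocalizedHeat

noncomputable section

/-! ### Gaussian tails of white noise -/

section Gaussian

variable {Ω : Type*} [MeasurableSpace Ω] {P : Measure Ω} {W : L2 → Ω → ℝ}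

theorem IsWhiteNoise.memLp_two (hW : IsWhiteNoise W P) (h : L2) : MemLp (W h) 2 P :=
  (hW.gaussian.hasGaussianLaw_eval h).memLp_two

theorem IsWhiteNoise.integrable_mul (hW : IsWhiteNoise W P) (h g : L2) :
    Integrable (fun ω => W h ω * W g ω) P :=
  (hW.memLp_two h).integrable_mul (hW.memLp_two g)

/-- The isonormal process is linear: the second moment of the defect is expanded by the covariance
formula and vanishes. -/
theorem IsWhiteNoise.smul_add_smul_ae_eq (hW : IsWhiteNoise W P) (a b : ℝ) (h g : L2) :
    W (a • h + b • g) =ᵐ[P] fun ω => a * W h ω + b * W g ω := by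
  set k : L2 := a • h + b • g with hk
  have e : ∀ ω, (W k ω - (a * W h ω + b * W g ω)) ^ 2 =
      W k ω * W k ω + a ^ 2 * (W h ω * W h ω) + b ^ 2 * (W g ω * W g ω)
        - 2 * a * (W k ω * W h ω) - 2 * b * (W k ω * W g ω) + 2 * a * b * (W h ω * W g ω) :=
    fun ω => by ring
  have i := hW.integrable_mul
  have hint : Integrable (fun ω => (W k ω - (a * W h ω + b * W g ω)) ^ 2) P := by
    simp only [e]
    exact (((((i k k).add ((i h h).const_mul _)).add ((i g g).const_mul _)).sub
      ((i k h).const_mul _)).sub ((i k g).const_mul _)).add ((i h g).const_mul _)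
  have h0 : ∫ ω, (W k ω - (a * W h ω + b * W g ω)) ^ 2 ∂P = 0 := by
    simp only [e]
    rw [integral_add, integral_sub, integral_sub, integral_add, integral_add]
    · simp only [integral_const_mul, hW.covariance]
      rw [hk]
      simp only [inner_add_left, inner_add_right, real_inner_smul_left, real_inner_smul_right]
      rw [real_inner_comm h g]
      ring
    all_goals
      first
        | exact i _ _
        | exact (i _ _).const_mul _
        | exact (i k k).add ((i h h).const_mul _)
        | exact ((i k k).add ((i h h).const_mul _)).add ((i g g).const_mul _)
        | exact (((i k k).add ((i h h).const_mul _)).add ((i g g).const_mul _)).sub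
            ((i k h).const_mul _)
        | exact ((((i k k).add ((i h h).const_mul _)).add ((i g g).const_mul _)).sub
            ((i k h).const_mul _)).sub ((i k g).const_mul _)
  rw [integral_eq_zero_iff_of_nonneg (fun ω => sq_nonneg _) hint] at h0
  filter_upwards [h0] with ω hω
  exact sub_eq_zero.1 (pow_eq_zero_iff (two_ne_zero) |>.1 hω)

theorem IsWhiteNoise.sub_ae_eq (hW : IsWhiteNoise W P) (h g : L2) :
    W (h - g) =ᵐ[P] fun ω => W h ω - W g ω := by
  have := hW.smul_add_smul_ae_eq 1 (-1) h g
  simp only [one_smul, neg_smul, ← sub_eq_add_neg, one_mul, neg_mul] at this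
  exact this

/-- `W h` has the law of `‖h‖` times a standard Gaussian variable. -/
theorem IsWhiteNoise.map_eq (hW : IsWhiteNoise W P) (h : L2) :
    P.map (W h) = (gaussianReal 0 1).map (fun x => ‖h‖ * x) := by
  rw [(hW.gaussian.hasGaussianLaw_eval h).map_eq_gaussianReal, hW.centered,
    gaussianReal_map_const_mul, mul_zero, mul_one,
    variance_of_integral_eq_zero (hW.gaussian.aemeasurable h) (hW.centered h)]
  congr 1
  have : ∫ ω, W h ω ^ 2 ∂P = ‖h‖ ^ 2 := by
    rw [← real_inner_self_eq_norm_sq, ← hW.covariance]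
    simp only [sq]
  rw [this]
  exact Real.toNNReal_of_nonneg _

/-- Markov's inequality for the `m`-th absolute moment of a Gaussian variable. -/
theorem IsWhiteNoise.exists_tail_bound (hW : IsWhiteNoise W P) (m : ℕ) :
    ∃ c : ℝ, 0 ≤ c ∧ ∀ h : L2, ∀ l : ℝ, 0 < l →
      P {ω | l ≤ |W h ω|} ≤ ENNReal.ofReal (c * (‖h‖ / l) ^ m) := by
  have hint : Integrable (fun x : ℝ => |x| ^ m) (gaussianReal 0 1) := by
    have := (memLp_id_gaussianReal (μ := 0) (v := 1) m).integrable_norm_pow'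
    simpa using this
  refine ⟨∫ x, |x| ^ m ∂gaussianReal 0 1, integral_nonneg fun x => by positivity, fun h l hl => ?_⟩
  have hms : MeasurableSet {x : ℝ | l ≤ |x|} := measurableSet_le measurable_const (by fun_prop)
  have h1 : P {ω | l ≤ |W h ω|} = gaussianReal 0 1 {x | l ≤ |‖h‖ * x|} := by
    have := DFunLike.congr_fun (hW.map_eq h) {x : ℝ | l ≤ |x|}
    rwa [Measure.map_apply_of_aemeasurable (hW.gaussian.aemeasurable h) hms,
      Measure.map_apply (by fun_prop) hms] at this
  rw [h1]
  calc gaussianReal 0 1 {x | l ≤ |‖h‖ * x|}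
      ≤ gaussianReal 0 1 {x | (1 : ENNReal) ≤ ENNReal.ofReal ((‖h‖ / l) ^ m * |x| ^ m)} := by
        refine measure_mono fun x hx => ?_
        simp only [mem_ofPred_eq] at hx ⊢
        rw [ENNReal.one_le_ofReal, ← mul_pow]
        refine one_le_pow₀ ?_
        rw [div_mul_eq_mul_div, one_le_div hl]
        rwa [abs_mul, abs_norm] at hx
    _ ≤ ∫⁻ x, ENNReal.ofReal ((‖h‖ / l) ^ m * |x| ^ m) ∂gaussianReal 0 1 := by
        have := mul_meas_ge_le_lintegral₀ (μ := gaussianReal 0 1)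
          (f := fun x => ENNReal.ofReal ((‖h‖ / l) ^ m * |x| ^ m)) (by fun_prop) 1
        simpa using this
    _ = _ := by
        rw [← ofReal_integral_eq_lintegral_ofReal (hint.const_mul _)
          (Eventually.of_forall fun x => by positivity), integral_const_mul, mul_comm]

end Gaussian

/-! ### Functions with decaying increments on the dyadic grids -/

/-- The point of the dyadic grid `2⁻ⁿ ℤ²` with integer coordinates `z`. -/
def gridPoint (n : ℕ) (z : ℤ × ℤ) : ℝ × ℝ := ((z.1 : ℝ) / 2 ^ n, (z.2 : ℝ) / 2 ^ n)

/-- The integer coordinates of the corner of the cell of `2⁻ⁿ ℤ²` that contains `p`. -/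
def gridIndex (n : ℕ) (p : ℝ × ℝ) : ℤ × ℤ := (⌊2 ^ n * p.1⌋, ⌊2 ^ n * p.2⌋)

theorem abs_floor_div_sub_le (n : ℕ) (x : ℝ) : |(⌊2 ^ n * x⌋ : ℝ) / 2 ^ n - x| ≤ 2⁻¹ ^ n := by
  have h1 := Int.floor_le ((2 : ℝ) ^ n * x)
  have h2 := (Int.lt_floor_add_one ((2 : ℝ) ^ n * x)).le
  have h : (0 : ℝ) < 2 ^ n := by positivity
  rw [inv_pow, div_sub' h.ne', abs_div, abs_of_pos h, div_le_iff₀ h, inv_mul_cancel₀ h.ne', abs_le]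
  constructor <;> linarith

theorem dist_gridPoint_gridIndex_le (n : ℕ) (p : ℝ × ℝ) :
    dist (gridPoint n (gridIndex n p)) p ≤ 2⁻¹ ^ n := by
  rw [Prod.dist_eq, max_le_iff, Real.dist_eq, Real.dist_eq]
  exact ⟨abs_floor_div_sub_le n p.1, abs_floor_div_sub_le n p.2⟩

theorem abs_floor_le {n N : ℕ} {x : ℝ} (hx : |x| ≤ N) : |⌊2 ^ n * x⌋| ≤ (N * 2 ^ n : ℤ) := by
  have h : (0 : ℝ) < 2 ^ n := by positivity
  rw [abs_le] at hx ⊢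
  constructor
  · rw [Int.le_floor]
    push_cast
    nlinarith
  · rw [← Int.lt_add_one_iff, Int.floor_lt]
    push_cast
    nlinarith

theorem abs_floor_sub_floor_le {n : ℕ} {x y : ℝ} (h : |x - y| ≤ 2⁻¹ ^ n) :
    |⌊2 ^ n * x⌋ - ⌊2 ^ n * y⌋| ≤ 1 := by
  have h0 : (0 : ℝ) < 2 ^ n := by positivity
  have h' : |2 ^ n * x - 2 ^ n * y| ≤ 1 := by
    rw [← mul_sub, abs_mul, abs_of_pos h0]
    calc _ ≤ (2 : ℝ) ^ n * 2⁻¹ ^ n := by gcongr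
      _ = 1 := by rw [← mul_pow]; norm_num
  rw [abs_le] at h' ⊢
  have a1 := Int.floor_le ((2 : ℝ) ^ n * x)
  have a2 := Int.lt_floor_add_one ((2 : ℝ) ^ n * x)
  have b1 := Int.floor_le ((2 : ℝ) ^ n * y)
  have b2 := Int.lt_floor_add_one ((2 : ℝ) ^ n * y)
  constructor
  · have : (⌊2 ^ n * y⌋ : ℝ) < ⌊2 ^ n * x⌋ + 2 := by linarith
    have : ⌊2 ^ n * y⌋ < ⌊2 ^ n * x⌋ + 2 := by exact_mod_cast this
    linarith
  · have : (⌊2 ^ n * x⌋ : ℝ) < ⌊2 ^ n * y⌋ + 2 := by linarith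
    have : ⌊2 ^ n * x⌋ < ⌊2 ^ n * y⌋ + 2 := by exact_mod_cast this
    linarith

theorem abs_floor_succ_sub_le (n : ℕ) (x : ℝ) :
    |2 * ⌊2 ^ n * x⌋ - ⌊2 ^ (n + 1) * x⌋| ≤ 1 := by
  have e : (2 : ℝ) ^ (n + 1) * x = 2 * (2 ^ n * x) := by ring
  rw [e]
  have a1 := Int.floor_le ((2 : ℝ) ^ n * x)
  have a2 := Int.lt_floor_add_one ((2 : ℝ) ^ n * x)
  have b1 := Int.floor_le (2 * ((2 : ℝ) ^ n * x))
  have b2 := Int.lt_floor_add_one (2 * ((2 : ℝ) ^ n * x))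
  rw [abs_le]
  constructor
  · have : (⌊2 * (2 ^ n * x)⌋ : ℝ) < 2 * ⌊2 ^ n * x⌋ + 2 := by linarith
    have : ⌊2 * (2 ^ n * x)⌋ < 2 * ⌊2 ^ n * x⌋ + 2 := by exact_mod_cast this
    linarith
  · have : (2 * ⌊2 ^ n * x⌋ : ℝ) < ⌊2 * (2 ^ n * x)⌋ + 1 := by linarith
    have : 2 * ⌊2 ^ n * x⌋ < ⌊2 * (2 ^ n * x)⌋ + 1 := by exact_mod_cast this
    linarith

/-- The increments of `f` between neighbouring points of the dyadic grids decay geometrically: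
on each box, those of level `n` are at most `rⁿ` for all large `n`. -/
def HasGridDecay (r : ℝ) (f : ℝ × ℝ → ℝ) : Prop :=
  ∀ N : ℕ, ∀ᶠ n : ℕ in atTop, ∀ z w : ℤ × ℤ, |z.1| ≤ N * 2 ^ n → |z.2| ≤ N * 2 ^ n →
    |z.1 - w.1| ≤ 1 → |z.2 - w.2| ≤ 1 → |f (gridPoint n z) - f (gridPoint n w)| ≤ r ^ n

/-- The limit of the values of `f` at the grid points next to `p`. -/
def gridLimit (f : ℝ × ℝ → ℝ) (p : ℝ × ℝ) : ℝ :=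
  limUnder atTop fun n => f (gridPoint n (gridIndex n p))

theorem abs_coord_le {p : ℝ × ℝ} {N : ℕ} (h : ‖p‖ ≤ N) : |p.1| ≤ N ∧ |p.2| ≤ N :=
  ⟨(norm_fst_le p).trans h, (norm_snd_le p).trans h⟩

/-- A point of the grid of level `n` also lies on the grid of level `n + 1`, where it neighbours or
equals the next approximation of `p`. -/
theorem HasGridDecay.eventually_step_le {r : ℝ} {f : ℝ × ℝ → ℝ} (hf : HasGridDecay r f)
    (hr0 : 0 ≤ r) (hr1 : r < 1) (N : ℕ) :
    ∀ᶠ n : ℕ in atTop, ∀ p : ℝ × ℝ, ‖p‖ ≤ N →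
      |f (gridPoint n (gridIndex n p)) - f (gridPoint (n + 1) (gridIndex (n + 1) p))| ≤ r ^ n := by
  have h := (tendsto_add_atTop_nat 1).eventually (hf N)
  filter_upwards [h] with n hn p hp
  obtain ⟨h1, h2⟩ := abs_coord_le hp
  have e : gridPoint n (gridIndex n p) =
      gridPoint (n + 1) (2 * ⌊2 ^ n * p.1⌋, 2 * ⌊2 ^ n * p.2⌋) := by
    simp only [gridPoint, gridIndex, pow_succ, Int.cast_mul, Int.cast_ofNat]
    congr 1 <;> · field_simp
  rw [e]
  have big : ∀ x : ℝ, |x| ≤ N → |2 * ⌊2 ^ n * x⌋| ≤ (N * 2 ^ (n + 1) : ℤ) := fun x hx => by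
    have := abs_floor_le (n := n) hx
    rw [abs_mul, pow_succ]
    simp only [abs_two]
    linarith
  have key := hn (2 * ⌊2 ^ n * p.1⌋, 2 * ⌊2 ^ n * p.2⌋) (gridIndex (n + 1) p) (big _ h1) (big _ h2)
    (abs_floor_succ_sub_le n p.1) (abs_floor_succ_sub_le n p.2)
  refine key.trans ?_
  exact pow_le_pow_of_le_one hr0 hr1.le (Nat.le_succ n)

theorem HasGridDecay.eventually_limit_le {r : ℝ} {f : ℝ × ℝ → ℝ} (hf : HasGridDecay r f)
    (hr0 : 0 ≤ r) (hr1 : r < 1) (N : ℕ) :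
    ∀ᶠ n : ℕ in atTop, ∀ p : ℝ × ℝ, ‖p‖ ≤ N →
      Tendsto (fun n => f (gridPoint n (gridIndex n p))) atTop (𝓝 (gridLimit f p)) ∧
      |f (gridPoint n (gridIndex n p)) - gridLimit f p| ≤ r ^ n / (1 - r) := by
  obtain ⟨n₀, h₀⟩ := eventually_atTop.1 (hf.eventually_step_le hr0 hr1 N)
  refine eventually_atTop.2 ⟨n₀, fun n hn p hp => ?_⟩
  set u : ℕ → ℝ := fun n => f (gridPoint n (gridIndex n p))
  have hd : ∀ k, dist (u (k + n)) (u (k + 1 + n)) ≤ r ^ n * r ^ k := fun k => by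
    rw [Real.dist_eq, ← pow_add, add_comm n k, add_right_comm]
    exact h₀ (k + n) (by omega) p hp
  have hc : CauchySeq fun k => u (k + n) := cauchySeq_of_le_geometric r _ hr1 hd
  obtain ⟨L, hL⟩ := cauchySeq_tendsto_of_complete hc
  have hL' : Tendsto u atTop (𝓝 L) := (tendsto_add_atTop_iff_nat n).1 hL
  have e : gridLimit f p = L := hL'.limUnder_eq
  refine ⟨e ▸ hL', ?_⟩
  have := dist_le_of_le_geometric_of_tendsto₀ r _ hr1 hd hL
  rw [zero_add, Real.dist_eq] at this
  rw [e]
  exact this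

theorem HasGridDecay.tendsto_gridLimit {r : ℝ} {f : ℝ × ℝ → ℝ} (hf : HasGridDecay r f)
    (hr0 : 0 ≤ r) (hr1 : r < 1) (p : ℝ × ℝ) :
    Tendsto (fun n => f (gridPoint n (gridIndex n p))) atTop (𝓝 (gridLimit f p)) := by
  obtain ⟨N, hN⟩ := exists_nat_ge ‖p‖
  obtain ⟨n, hn⟩ := (hf.eventually_limit_le hr0 hr1 N).exists
  exact (hn p hN).1

theorem HasGridDecay.continuous_gridLimit {r : ℝ} {f : ℝ × ℝ → ℝ} (hf : HasGridDecay r f)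
    (hr0 : 0 ≤ r) (hr1 : r < 1) : Continuous (gridLimit f) := by
  refine continuous_iff_continuousAt.2 fun p => Metric.continuousAt_iff.2 fun ε hε => ?_
  obtain ⟨N, hN⟩ := exists_nat_ge (‖p‖ + 1)
  have hpos : 0 < 1 - r := by linarith
  have hlim : Tendsto (fun n => r ^ n / (1 - r) + r ^ n + r ^ n / (1 - r)) atTop (𝓝 0) := by
    have h := tendsto_pow_atTop_nhds_zero_of_lt_one hr0 hr1
    have h' := h.div_const (1 - r)
    simpa using (h'.add h).add h'
  obtain ⟨n, hn1, hn2, hn3⟩ := ((hf.eventually_limit_le hr0 hr1 N).and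
    ((hf N).and (hlim.eventually_lt_const hε))).exists
  refine ⟨2⁻¹ ^ n, by positivity, fun q hq => ?_⟩
  have hq1 : ‖q‖ ≤ N := by
    have : dist q p ≤ 1 := hq.le.trans (pow_le_one₀ (by norm_num) (by norm_num))
    rw [dist_eq_norm] at this
    linarith [norm_le_norm_add_norm_sub' q p]
  have hp1 : ‖p‖ ≤ N := by linarith
  rw [Prod.dist_eq, max_lt_iff, Real.dist_eq, Real.dist_eq] at hq
  obtain ⟨q1, q2⟩ := abs_coord_le hq1
  have a := (hn1 q hq1).2
  have b := (hn1 p hp1).2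
  have c := hn2 (gridIndex n q) (gridIndex n p) (abs_floor_le q1) (abs_floor_le q2)
    (abs_floor_sub_floor_le hq.1.le) (abs_floor_sub_floor_le hq.2.le)
  rw [Real.dist_eq]
  rw [abs_le] at a b c
  refine lt_of_le_of_lt (abs_le.2 ⟨?_, ?_⟩) hn3 <;> linarith

theorem gridPoint_norm_le {n N : ℕ} {z : ℤ × ℤ} (h1 : |z.1| ≤ N * 2 ^ n) (h2 : |z.2| ≤ N * 2 ^ n) :
    ‖gridPoint n z‖ ≤ N := by
  have key : ∀ k : ℤ, |k| ≤ N * 2 ^ n → ‖(k : ℝ) / 2 ^ n‖ ≤ N := fun k hk => by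
    rw [Real.norm_eq_abs, abs_div, abs_of_pos (by positivity : (0 : ℝ) < 2 ^ n),
      div_le_iff₀ (by positivity)]
    exact_mod_cast hk
  exact max_le (key _ h1) (key _ h2)

theorem dist_gridPoint_le {n : ℕ} {z w : ℤ × ℤ} (h1 : |z.1 - w.1| ≤ 1) (h2 : |z.2 - w.2| ≤ 1) :
    dist (gridPoint n z) (gridPoint n w) ≤ 2⁻¹ ^ n := by
  have key : ∀ k l : ℤ, |k - l| ≤ 1 → dist ((k : ℝ) / 2 ^ n) ((l : ℝ) / 2 ^ n) ≤ 2⁻¹ ^ n :=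
    fun k l h => by
    have h' : |(k : ℝ) - l| ≤ 1 := by exact_mod_cast h
    rw [Real.dist_eq, ← sub_div, abs_div, abs_of_pos (by positivity : (0 : ℝ) < 2 ^ n), inv_pow,
      div_eq_mul_inv]
    exact mul_le_of_le_one_left (by positivity) h'
  exact max_le (key _ _ h1) (key _ _ h2)

/-! ### The Kolmogorov continuity theorem in the plane -/

section Kolmogorov

variable {Ω : Type*} [MeasurableSpace Ω] {P : Measure Ω} {X : ℝ × ℝ → Ω → ℝ} {b r ρ : ℝ} {m : ℕ}

/-- A weak-type form of the moment condition in the Kolmogorov continuity theorem, locally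
uniformly in the parameters; Markov's inequality derives it from
`E |X p - X q| ^ m ≤ C * dist p q ^ b`. -/
def HasIncrementTail (P : Measure Ω) (X : ℝ × ℝ → Ω → ℝ) (m : ℕ) (b : ℝ) : Prop :=
  ∀ N : ℕ, ∃ C : ℝ, 0 ≤ C ∧ ∀ p q : ℝ × ℝ, ‖p‖ ≤ N → ‖q‖ ≤ N → dist p q ≤ 1 → ∀ l : ℝ, 0 < l →
    P {ω | l ≤ |X p ω - X q ω|} ≤ ENNReal.ofReal (C * dist p q ^ b / l ^ m)

/-- The numbers `r` and `ρ` share the decay of `2⁻¹ ^ (n * b)` that remains after `4⁻¹ ^ n`, which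
pays for the number of grid points. -/
theorem HasIncrementTail.exists_level_bound (hX : HasIncrementTail P X m b) (hb : 0 ≤ b)
    (hr : 0 < r) (hρr : (2⁻¹ : ℝ) ^ b = 4⁻¹ * ρ * r ^ m) (N : ℕ) :
    ∃ C : ℝ, 0 ≤ C ∧ ∀ n : ℕ, ∀ p q : ℝ × ℝ, ‖p‖ ≤ N → ‖q‖ ≤ N → dist p q ≤ 2⁻¹ ^ n →
      P {ω | r ^ n ≤ |X p ω - X q ω|} ≤ ENNReal.ofReal (C * (4⁻¹ ^ n * ρ ^ n)) := by
  obtain ⟨C, hC, h⟩ := hX N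
  refine ⟨C, hC, fun n p q hp hq hd => ?_⟩
  refine (h p q hp hq (hd.trans (pow_le_one₀ (by norm_num) (by norm_num))) (r ^ n)
    (by positivity)).trans (ENNReal.ofReal_le_ofReal ?_)
  rw [mul_div_assoc]
  refine mul_le_mul_of_nonneg_left ?_ hC
  rw [div_le_iff₀ (by positivity)]
  calc dist p q ^ b ≤ ((2⁻¹ : ℝ) ^ n) ^ b := Real.rpow_le_rpow dist_nonneg hd hb
    _ = ((2⁻¹ : ℝ) ^ b) ^ n := by
      rw [← Real.rpow_natCast, ← Real.rpow_natCast, ← Real.rpow_mul (by norm_num),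
        ← Real.rpow_mul (by norm_num), mul_comm]
    _ = 4⁻¹ ^ n * ρ ^ n * (r ^ n) ^ m := by
      rw [hρr, mul_pow, mul_pow, ← pow_mul, ← pow_mul, mul_comm m n]

theorem tsum_ofReal_geometric_ne_top (K : ℝ) (hρ0 : 0 ≤ ρ) (hρ1 : ρ < 1) :
    ∑' n : ℕ, ENNReal.ofReal (K * ρ ^ n) ≠ ⊤ :=
  ((summable_geometric_of_lt_one hρ0 hρ1).mul_left K).tsum_ofReal_ne_top

/-- Borel–Cantelli for the increments on the grids: a box contains `O(4 ^ n)` pairs of neighbours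
of level `n`, and each increment exceeds `r ^ n` with probability `O(4⁻¹ ^ n * ρ ^ n)`. -/
theorem HasIncrementTail.ae_hasGridDecay (hX : HasIncrementTail P X m b) (hb : 0 ≤ b)
    (hr : 0 < r) (hρ0 : 0 ≤ ρ) (hρ1 : ρ < 1) (hρr : (2⁻¹ : ℝ) ^ b = 4⁻¹ * ρ * r ^ m) :
    ∀ᵐ ω ∂P, HasGridDecay r fun p => X p ω := by
  unfold HasGridDecay
  rw [ae_all_iff]
  intro N
  obtain ⟨C, hC, h⟩ := hX.exists_level_bound hb hr hρr (N + 1)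
  -- the grid indices of level `n` in the box, and the steps to the neighbours
  let S : ℕ → Finset (ℤ × ℤ) := fun n =>
    Finset.Icc (-((N : ℤ) * 2 ^ n)) (N * 2 ^ n) ×ˢ Finset.Icc (-((N : ℤ) * 2 ^ n)) (N * 2 ^ n)
  let E : Finset (ℤ × ℤ) := Finset.Icc (-1) 1 ×ˢ Finset.Icc (-1) 1
  let B : ℕ → Set Ω := fun n => ⋃ z ∈ S n, ⋃ e ∈ E,
    {ω | r ^ n ≤ |X (gridPoint n z) ω - X (gridPoint n (z - e)) ω|}
  have hcard : ∀ n, ((S n).card : ℝ) ≤ (2 * N + 1) ^ 2 * 4 ^ n := fun n => by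
    have e1 : ((Finset.Icc (-(N * 2 ^ n : ℤ)) (N * 2 ^ n)).card : ℝ) = 2 * N * 2 ^ n + 1 := by
      rw [Int.card_Icc]
      have : ((N * 2 ^ n + 1 - -(N * 2 ^ n) : ℤ).toNat : ℤ) = 2 * N * 2 ^ n + 1 := by
        have : (0 : ℤ) ≤ N * 2 ^ n := by positivity
        rw [Int.toNat_of_nonneg (by linarith)]; ring
      exact_mod_cast this
    have e2 : (1 : ℝ) ≤ 2 ^ n := one_le_pow₀ (by norm_num)
    have e4 : (4 : ℝ) ^ n = (2 ^ n) ^ 2 := by rw [← pow_mul, mul_comm, pow_mul]; norm_num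
    rw [Finset.card_product, Nat.cast_mul, e1, e4, ← mul_pow, ← sq]
    gcongr
    linarith
  have hB : ∀ n, P (B n) ≤ ENNReal.ofReal ((2 * N + 1) ^ 2 * 9 * C * ρ ^ n) := fun n => by
    calc P (B n) ≤ ∑ z ∈ S n, ∑ e ∈ E,
          P {ω | r ^ n ≤ |X (gridPoint n z) ω - X (gridPoint n (z - e)) ω|} :=
          (measure_biUnion_finset_le _ _).trans
            (Finset.sum_le_sum fun z _ => measure_biUnion_finset_le _ _)
      _ ≤ ∑ z ∈ S n, ∑ e ∈ E, ENNReal.ofReal (C * (4⁻¹ ^ n * ρ ^ n)) := by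
          refine Finset.sum_le_sum fun z hz => Finset.sum_le_sum fun e he => ?_
          simp only [S, E, Finset.mem_product, Finset.mem_Icc] at hz he
          obtain ⟨⟨z1, z2⟩, z3, z4⟩ := hz
          obtain ⟨⟨e1, e2⟩, e3, e4⟩ := he
          have hpow : (1 : ℤ) ≤ 2 ^ n := one_le_pow₀ (by norm_num)
          refine h n _ _ ?_ ?_ ?_
          · refine gridPoint_norm_le ?_ ?_ <;> rw [abs_le] <;> push_cast <;>
              constructor <;> linarith
          · refine gridPoint_norm_le ?_ ?_ <;> rw [abs_le] <;> push_cast <;>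
              simp only [Prod.fst_sub, Prod.snd_sub] <;> constructor <;> linarith
          · refine dist_gridPoint_le ?_ ?_ <;> rw [abs_le] <;>
              simp only [Prod.fst_sub, Prod.snd_sub] <;> constructor <;> linarith
      _ = ENNReal.ofReal ((S n).card * 9 * (C * (4⁻¹ ^ n * ρ ^ n))) := by
          have hE : E.card = 9 := by decide
          rw [Finset.sum_const, Finset.sum_const, hE, ← ENNReal.ofReal_nsmul,
            ← ENNReal.ofReal_nsmul, nsmul_eq_mul, nsmul_eq_mul, mul_assoc]
          norm_num
      _ ≤ _ := by
          refine ENNReal.ofReal_le_ofReal ?_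
          calc ((S n).card : ℝ) * 9 * (C * (4⁻¹ ^ n * ρ ^ n))
              ≤ ((2 * N + 1) ^ 2 * 4 ^ n) * 9 * (C * (4⁻¹ ^ n * ρ ^ n)) := by
                gcongr
                exact hcard n
            _ = (2 * N + 1) ^ 2 * 9 * C * ρ ^ n * (4 ^ n * 4⁻¹ ^ n) := by ring
            _ = _ := by rw [← mul_pow]; norm_num
  have hsum : ∑' n, P (B n) ≠ ⊤ :=
    ne_top_of_le_ne_top (tsum_ofReal_geometric_ne_top _ hρ0 hρ1) (ENNReal.tsum_le_tsum hB)
  filter_upwards [ae_eventually_notMem hsum] with ω hω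
  filter_upwards [hω] with n hn z w z1 z2 h1 h2
  by_contra! hlt
  refine hn (mem_iUnion₂.2 ⟨z, ?_, mem_iUnion₂.2 ⟨z - w, ?_, ?_⟩⟩)
  · simp only [S, Finset.mem_product, Finset.mem_Icc]
    exact ⟨abs_le.1 z1, abs_le.1 z2⟩
  · simp only [E, Finset.mem_product, Finset.mem_Icc]
    exact ⟨abs_le.1 h1, abs_le.1 h2⟩
  · rw [sub_sub_cancel]
    exact hlt.le

theorem HasIncrementTail.ae_tendsto_gridPoint (hX : HasIncrementTail P X m b) (hb : 0 ≤ b)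
    (hr : 0 < r) (hr1 : r < 1) (hρ0 : 0 ≤ ρ) (hρ1 : ρ < 1)
    (hρr : (2⁻¹ : ℝ) ^ b = 4⁻¹ * ρ * r ^ m) (p : ℝ × ℝ) :
    ∀ᵐ ω ∂P, Tendsto (fun n => X (gridPoint n (gridIndex n p)) ω) atTop (𝓝 (X p ω)) := by
  obtain ⟨N, hN⟩ := exists_nat_ge (‖p‖ + 1)
  obtain ⟨C, hC, h⟩ := hX.exists_level_bound hb hr hρr N
  let B : ℕ → Set Ω := fun n => {ω | r ^ n ≤ |X (gridPoint n (gridIndex n p)) ω - X p ω|}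
  have hB : ∀ n, P (B n) ≤ ENNReal.ofReal (C * ρ ^ n) := fun n => by
    have hd := dist_gridPoint_gridIndex_le n p
    have hd1 : dist (gridPoint n (gridIndex n p)) p ≤ 1 :=
      hd.trans (pow_le_one₀ (by norm_num) (by norm_num))
    rw [dist_eq_norm] at hd1
    refine (h n _ _ ?_ ?_ hd).trans (ENNReal.ofReal_le_ofReal ?_)
    · linarith [norm_le_norm_add_norm_sub' (gridPoint n (gridIndex n p)) p]
    · linarith
    · refine mul_le_mul_of_nonneg_left ?_ hC
      exact mul_le_of_le_one_left (by positivity) (pow_le_one₀ (by norm_num) (by norm_num))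
  have hsum : ∑' n, P (B n) ≠ ⊤ :=
    ne_top_of_le_ne_top (tsum_ofReal_geometric_ne_top _ hρ0 hρ1) (ENNReal.tsum_le_tsum hB)
  filter_upwards [ae_eventually_notMem hsum] with ω hω
  rw [tendsto_iff_dist_tendsto_zero]
  refine squeeze_zero' (Eventually.of_forall fun _ => dist_nonneg) ?_
    (tendsto_pow_atTop_nhds_zero_of_lt_one hr.le hr1)
  filter_upwards [hω] with n hn
  exact (not_le.1 hn).le

/-- The Kolmogorov continuity theorem for processes indexed by the plane, whose dimension `2` is
the lower bound for `b`. -/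
theorem HasIncrementTail.exists_continuous_version (hX : HasIncrementTail P X m b) (hm : m ≠ 0)
    (hb : 2 < b) :
    ∃ Y : ℝ × ℝ → Ω → ℝ, (∀ p, Y p =ᵐ[P] X p) ∧ ∀ᵐ ω ∂P, Continuous fun p => Y p ω := by
  -- half of the excess `b - 2` goes into the size of the increments,
  -- the other half into the summability
  set ρ : ℝ := 2⁻¹ ^ ((b - 2) / 2)
  set r : ℝ := 2⁻¹ ^ ((b - 2) / 2 / m)
  have hm' : (0 : ℝ) < m := by positivity
  have hb' : 0 < (b - 2) / 2 := by linarith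
  have hr0 : 0 < r := by positivity
  have hr1 : r < 1 := Real.rpow_lt_one (by norm_num) (by norm_num) (by positivity)
  have hρ0 : 0 ≤ ρ := by positivity
  have hρ1 : ρ < 1 := Real.rpow_lt_one (by norm_num) (by norm_num) hb'
  have hρr : (2⁻¹ : ℝ) ^ b = 4⁻¹ * ρ * r ^ m := by
    have e1 : r ^ m = ρ := by
      rw [← Real.rpow_natCast, ← Real.rpow_mul (by norm_num), div_mul_cancel₀ _ hm'.ne']
    have e2 : (4⁻¹ : ℝ) = 2⁻¹ ^ (2 : ℝ) := by rw [Real.rpow_two]; norm_num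
    rw [e1, e2, ← Real.rpow_add (by norm_num), ← Real.rpow_add (by norm_num)]
    congr 1
    ring
  have hdec := hX.ae_hasGridDecay (by linarith) hr0 hρ0 hρ1 hρr
  refine ⟨fun p ω => gridLimit (fun q => X q ω) p, fun p => ?_, ?_⟩
  · filter_upwards [hdec, hX.ae_tendsto_gridPoint (by linarith) hr0 hr1 hρ0 hρ1 hρr p]
      with ω h1 h2
    exact tendsto_nhds_unique (h1.tendsto_gridLimit hr0.le hr1 p) h2
  · filter_upwards [hdec] with ω h
    exact h.continuous_gridLimit hr0.le hr1

end Kolmogorov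

/-! ### Hölder and tail bounds for the heat kernel -/

theorem heatKernel_nonneg {s : ℝ} (hs : 0 < s) (y : ℝ) : 0 ≤ heatKernel s y := by
  unfold heatKernel; positivity

theorem four_pi_rpow_le {s : ℝ} (hs : 0 < s) :
    (4 * Real.pi * s) ^ (-(1 / 2) : ℝ) ≤ s ^ (-(1 / 2) : ℝ) := by
  apply Real.rpow_le_rpow_of_nonpos hs
  · nlinarith [Real.pi_gt_three]
  · norm_num

theorem heatKernel_le {s : ℝ} (hs : 0 < s) (y : ℝ) :
    heatKernel s y ≤ s ^ (-(1 / 2) : ℝ) * Real.exp (-(y ^ 2 / (4 * s))) := by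
  unfold heatKernel
  rw [neg_div]
  exact mul_le_mul_of_nonneg_right (four_pi_rpow_le hs) (Real.exp_nonneg _)

theorem heatKernel_le_rpow {s : ℝ} (hs : 0 < s) (y : ℝ) : heatKernel s y ≤ s ^ (-(1 / 2) : ℝ) := by
  refine (heatKernel_le hs y).trans (mul_le_of_le_one_right (by positivity) ?_)
  rw [Real.exp_le_one_iff]
  have : 0 ≤ y ^ 2 / (4 * s) := by positivity
  linarith

theorem hasDerivAt_heatKernel_space {s : ℝ} (hs : 0 < s) (y : ℝ) :
    HasDerivAt (heatKernel s) (heatKernel s y * (-y / (2 * s))) y := by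
  have h1 : HasDerivAt (fun y : ℝ => -y ^ 2 / (4 * s)) (-y / (2 * s)) y := by
    have := ((hasDerivAt_pow 2 y).neg).div_const (4 * s)
    refine this.congr_deriv ?_
    field_simp
    norm_num
    ring
  refine (h1.exp.const_mul ((4 * Real.pi * s) ^ (-(1 / 2) : ℝ))).congr_deriv ?_
  unfold heatKernel
  ring

theorem hasDerivAt_heatKernel_time {s : ℝ} (hs : 0 < s) (y : ℝ) :
    HasDerivAt (fun s => heatKernel s y)
      (heatKernel s y * (y ^ 2 / (4 * s ^ 2) - 1 / (2 * s))) s := by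
  have h1 : HasDerivAt (fun s : ℝ => -y ^ 2 / (4 * s)) (y ^ 2 / (4 * s ^ 2)) s := by
    have := (hasDerivAt_const s (-y ^ 2)).div ((hasDerivAt_id s).const_mul 4)
      (by simpa using hs.ne')
    refine this.congr_deriv ?_
    simp only [id]
    field_simp
    ring
  have h2 : HasDerivAt (fun s : ℝ => (4 * Real.pi * s) ^ (-(1 / 2) : ℝ))
      ((4 * Real.pi * s) ^ (-(1 / 2) : ℝ) * (-(1 / (2 * s)))) s := by
    have hp : 0 < 4 * Real.pi * s := by positivity
    have := ((hasDerivAt_id s).const_mul (4 * Real.pi)).rpow_const (p := (-(1 / 2) : ℝ))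
      (Or.inl hp.ne')
    refine this.congr_deriv ?_
    simp only [id, mul_one]
    rw [Real.rpow_sub_one hp.ne']
    field_simp
  refine (h2.mul h1.exp).congr_deriv ?_
  unfold heatKernel
  ring

theorem mul_exp_neg_sq_le_one (u : ℝ) : u * Real.exp (-u ^ 2) ≤ 1 := by
  rw [Real.exp_neg, ← div_eq_mul_inv, div_le_one (Real.exp_pos _)]
  have := Real.add_one_le_exp (u ^ 2)
  nlinarith [sq_nonneg (u - 1)]

theorem abs_sub_half_mul_exp_neg_le_one {v : ℝ} (hv : 0 ≤ v) :
    |v - 1 / 2| * Real.exp (-v) ≤ 1 := by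
  rw [Real.exp_neg, ← div_eq_mul_inv, div_le_one (Real.exp_pos _)]
  have := Real.add_one_le_exp v
  rw [abs_le]
  constructor <;> linarith

theorem abs_deriv_heatKernel_space_le {s : ℝ} (hs : 0 < s) (y : ℝ) :
    |heatKernel s y * (-y / (2 * s))| ≤ s⁻¹ := by
  have hu := mul_exp_neg_sq_le_one (|y| / (2 * √s))
  have e1 : (|y| / (2 * √s)) ^ 2 = y ^ 2 / (4 * s) := by
    rw [div_pow, mul_pow, Real.sq_sqrt hs.le, sq_abs]; norm_num
  rw [e1] at hu
  have e2 : s ^ (-(1 / 2) : ℝ) = (√s)⁻¹ := by rw [Real.rpow_neg hs.le, Real.sqrt_eq_rpow]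
  have e3 : √s * √s = s := Real.mul_self_sqrt hs.le
  have hs' : 0 < √s := Real.sqrt_pos.2 hs
  rw [abs_mul, abs_of_nonneg (heatKernel_nonneg hs y), abs_div, abs_neg,
    abs_of_pos (by positivity : 0 < 2 * s)]
  calc heatKernel s y * (|y| / (2 * s))
      ≤ s ^ (-(1 / 2) : ℝ) * Real.exp (-(y ^ 2 / (4 * s))) * (|y| / (2 * s)) :=
        mul_le_mul_of_nonneg_right (heatKernel_le hs y) (by positivity)
    _ = s⁻¹ * (|y| / (2 * √s) * Real.exp (-(y ^ 2 / (4 * s)))) := by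
        have e4 : s⁻¹ = (√s)⁻¹ * (√s)⁻¹ := by rw [← mul_inv, e3]
        rw [e2, div_eq_mul_inv, div_eq_mul_inv, mul_inv, mul_inv, e4]
        ring
    _ ≤ s⁻¹ := mul_le_of_le_one_right (by positivity) hu

theorem abs_deriv_heatKernel_time_le {s : ℝ} (hs : 0 < s) (y : ℝ) :
    |heatKernel s y * (y ^ 2 / (4 * s ^ 2) - 1 / (2 * s))| ≤ s ^ (-(3 / 2) : ℝ) := by
  have hv := abs_sub_half_mul_exp_neg_le_one (v := y ^ 2 / (4 * s)) (by positivity)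
  have e1 : y ^ 2 / (4 * s ^ 2) - 1 / (2 * s) = (y ^ 2 / (4 * s) - 1 / 2) / s := by
    field_simp
  have e2 : s ^ (-(3 / 2) : ℝ) = s ^ (-(1 / 2) : ℝ) / s := by
    rw [← Real.rpow_sub_one hs.ne']; norm_num
  rw [e1, e2, abs_mul, abs_of_nonneg (heatKernel_nonneg hs y), abs_div, abs_of_pos hs]
  calc _ ≤ s ^ (-(1 / 2) : ℝ) * Real.exp (-(y ^ 2 / (4 * s))) *
        (|y ^ 2 / (4 * s) - 1 / 2| / s) :=
        mul_le_mul_of_nonneg_right (heatKernel_le hs y) (by positivity)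
    _ = s ^ (-(1 / 2) : ℝ) / s *
        (|y ^ 2 / (4 * s) - 1 / 2| * Real.exp (-(y ^ 2 / (4 * s)))) := by ring
    _ ≤ _ := mul_le_of_le_one_right (by positivity) hv

theorem le_rpow_mul_rpow {x A B θ : ℝ} (hx : 0 ≤ x) (hA : x ≤ A) (hB : x ≤ B) (h0 : 0 ≤ θ)
    (h1 : θ ≤ 1) : x ≤ A ^ (1 - θ) * B ^ θ := by
  rcases hx.eq_or_lt with rfl | hx
  · positivity
  calc x = x ^ (1 - θ) * x ^ θ := by rw [← Real.rpow_add hx]; simp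
    _ ≤ _ := mul_le_mul (Real.rpow_le_rpow hx.le hA (by linarith)) (Real.rpow_le_rpow hx.le hB h0)
        (by positivity) (Real.rpow_nonneg (hx.le.trans hA) _)

theorem abs_heatKernel_sub_le_rpow {s s' : ℝ} (hs : 0 < s) (hss' : s ≤ s') (y z : ℝ) :
    |heatKernel s' y - heatKernel s z| ≤ s ^ (-(1 / 2) : ℝ) := by
  have hs' := hs.trans_le hss'
  have a := heatKernel_nonneg hs' y
  have b := heatKernel_nonneg hs z
  have c := heatKernel_le_rpow hs' y
  have d := heatKernel_le_rpow hs z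
  have e : s' ^ (-(1 / 2) : ℝ) ≤ s ^ (-(1 / 2) : ℝ) :=
    Real.rpow_le_rpow_of_nonpos hs hss' (by norm_num)
  rw [abs_le]
  constructor <;> linarith

/-- Interpolation between the sup bound `s ^ (-1/2)` and the Lipschitz bound `s⁻¹ |y - z|`, so that
the singularity at `s = 0` stays integrable. -/
theorem abs_heatKernel_sub_space_le {s : ℝ} (hs : 0 < s) (y z : ℝ) :
    |heatKernel s y - heatKernel s z| ≤ |y - z| ^ (1 / 2 : ℝ) * s ^ (-(3 / 4) : ℝ) := by
  have h1 : |heatKernel s y - heatKernel s z| ≤ s⁻¹ * |y - z| :=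
    convex_univ.norm_image_sub_le_of_norm_hasDerivWithin_le
      (fun x _ => (hasDerivAt_heatKernel_space hs x).hasDerivWithinAt)
      (fun x _ => abs_deriv_heatKernel_space_le hs x) (mem_univ z) (mem_univ y)
  refine (le_rpow_mul_rpow (θ := 1 / 2) (abs_nonneg _) (abs_heatKernel_sub_le_rpow hs le_rfl y z) h1
    (by norm_num) (by norm_num)).trans_eq ?_
  rw [Real.mul_rpow (by positivity) (abs_nonneg _), ← Real.rpow_neg_one, ← Real.rpow_mul hs.le,
    ← Real.rpow_mul hs.le, ← mul_assoc, ← Real.rpow_add hs, mul_comm]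
  norm_num

/-- Interpolation between the sup bound `s ^ (-1/2)` and the Lipschitz bound
`s ^ (-3/2) (s' - s)`. -/
theorem abs_heatKernel_sub_time_le {s s' : ℝ} (hs : 0 < s) (hss' : s ≤ s') (y : ℝ) :
    |heatKernel s' y - heatKernel s y| ≤ (s' - s) ^ (1 / 4 : ℝ) * s ^ (-(3 / 4) : ℝ) := by
  have h1 : |heatKernel s' y - heatKernel s y| ≤ s ^ (-(3 / 2) : ℝ) * |s' - s| := by
    refine (convex_Ici s).norm_image_sub_le_of_norm_hasDerivWithin_le
      (f := fun s => heatKernel s y)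
      (fun x hx => (hasDerivAt_heatKernel_time (hs.trans_le hx) y).hasDerivWithinAt)
      (fun x hx => ?_) (mem_Ici.2 le_rfl) (mem_Ici.2 hss')
    exact (abs_deriv_heatKernel_time_le (hs.trans_le hx) y).trans
      (Real.rpow_le_rpow_of_nonpos hs hx (by norm_num))
  refine (le_rpow_mul_rpow (θ := 1 / 4) (abs_nonneg _) (abs_heatKernel_sub_le_rpow hs hss' y y) h1
    (by norm_num) (by norm_num)).trans_eq ?_
  rw [Real.mul_rpow (by positivity) (abs_nonneg _), ← Real.rpow_mul hs.le,
    ← Real.rpow_mul hs.le, ← mul_assoc, ← Real.rpow_add hs, mul_comm,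
    abs_of_nonneg (sub_nonneg.2 hss')]
  norm_num

theorem heatKernel_sub_sq_le {s s' : ℝ} (hs : 0 < s) (hss' : s ≤ s') (y z : ℝ) :
    (heatKernel s' y - heatKernel s z) ^ 2 ≤
      ((s' - s) ^ (1 / 4 : ℝ) + |y - z| ^ (1 / 2 : ℝ)) * s ^ (-(3 / 4) : ℝ) *
        (heatKernel s' y + heatKernel s z) := by
  have a := heatKernel_nonneg (hs.trans_le hss') y
  have b := heatKernel_nonneg hs z
  have h1 : |heatKernel s' y - heatKernel s z| ≤
      ((s' - s) ^ (1 / 4 : ℝ) + |y - z| ^ (1 / 2 : ℝ)) * s ^ (-(3 / 4) : ℝ) := by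
    rw [add_mul]
    exact (abs_sub_le _ (heatKernel s y) _).trans
      (add_le_add (abs_heatKernel_sub_time_le hs hss' y) (abs_heatKernel_sub_space_le hs y z))
  have h2 : |heatKernel s' y - heatKernel s z| ≤ heatKernel s' y + heatKernel s z := by
    rw [abs_le]; constructor <;> linarith
  rw [← sq_abs, sq]
  exact mul_le_mul h1 h2 (abs_nonneg _) ((abs_nonneg _).trans h1)

theorem measurable_heatKernel (s : ℝ) : Measurable (heatKernel s) := by
  unfold heatKernel; fun_prop

theorem lintegral_heatKernel {s : ℝ} (hs : 0 < s) (x : ℝ) :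
    ∫⁻ y, ENNReal.ofReal (heatKernel s (y - x)) = 1 := by
  have hv : (2 * s).toNNReal ≠ 0 := by
    rw [Ne, Real.toNNReal_eq_zero, not_le]; positivity
  simp only [heatKernel_eq hs]
  rw [lintegral_sub_right_eq_self
    (fun y => ENNReal.ofReal (gaussianPDFReal 0 (2 * s).toNNReal y)) x]
  exact lintegral_gaussianPDFReal_eq_one 0 hv

theorem lintegral_heatKernel_sub_sq_le {s s' : ℝ} (hs : 0 < s) (hss' : s ≤ s') (x x' : ℝ) :
    ∫⁻ y, ENNReal.ofReal ((heatKernel s' (y - x') - heatKernel s (y - x)) ^ 2) ≤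
      ENNReal.ofReal (2 * ((s' - s) ^ (1 / 4 : ℝ) + |x' - x| ^ (1 / 2 : ℝ)) *
        s ^ (-(3 / 4) : ℝ)) := by
  set K : ℝ := ((s' - s) ^ (1 / 4 : ℝ) + |x' - x| ^ (1 / 2 : ℝ)) * s ^ (-(3 / 4) : ℝ) with hK
  have hss : 0 ≤ s' - s := sub_nonneg.2 hss'
  have hK0 : 0 ≤ K := by positivity
  have hs' := hs.trans_le hss'
  have m := measurable_heatKernel
  calc _ ≤ ∫⁻ y, ENNReal.ofReal K * (ENNReal.ofReal (heatKernel s' (y - x')) +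
        ENNReal.ofReal (heatKernel s (y - x))) := by
        refine lintegral_mono fun y => ?_
        rw [← ENNReal.ofReal_add (heatKernel_nonneg hs' _) (heatKernel_nonneg hs _),
          ← ENNReal.ofReal_mul hK0]
        refine ENNReal.ofReal_le_ofReal ((heatKernel_sub_sq_le hs hss' _ _).trans_eq ?_)
        rw [show y - x' - (y - x) = -(x' - x) by ring, abs_neg]
    _ = ENNReal.ofReal K * 2 := by
        rw [lintegral_const_mul, lintegral_add_left, lintegral_heatKernel hs',
          lintegral_heatKernel hs, one_add_one_eq_two]
        · exact ((m s').comp (by fun_prop)).ennreal_ofReal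
        · exact ((m s').comp (by fun_prop)).ennreal_ofReal.add
            ((m s).comp (by fun_prop)).ennreal_ofReal
    _ = _ := by
        rw [← ENNReal.ofReal_ofNat 2, ← ENNReal.ofReal_mul hK0]
        congr 1
        rw [hK]
        ring

/-- If `G_s ≤ M` on the translate of `A`, then the square of the kernel integrates to at most `M`
over `A`. -/
theorem setLIntegral_heatKernel_sq_le_of_le {s x M : ℝ} (hs : 0 < s) {A : Set ℝ}
    (hA : MeasurableSet A) (hM : ∀ y ∈ A, heatKernel s (y - x) ≤ M) :
    ∫⁻ y in A, ENNReal.ofReal (heatKernel s (y - x) ^ 2) ≤ ENNReal.ofReal M := by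
  calc _ ≤ ∫⁻ y in A, ENNReal.ofReal M * ENNReal.ofReal (heatKernel s (y - x)) := by
        refine setLIntegral_mono' hA fun y hy => ?_
        have h := hM y hy
        have h0 := heatKernel_nonneg hs (y - x)
        rw [← ENNReal.ofReal_mul (h0.trans h), sq]
        exact ENNReal.ofReal_le_ofReal (mul_le_mul_of_nonneg_right h h0)
    _ ≤ ∫⁻ y, ENNReal.ofReal M * ENNReal.ofReal (heatKernel s (y - x)) :=
        setLIntegral_le_lintegral _ _
    _ = _ := by
        rw [lintegral_const_mul, lintegral_heatKernel hs, mul_one]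
        exact ((measurable_heatKernel s).comp (by fun_prop)).ennreal_ofReal

theorem lintegral_heatKernel_sq_le {s : ℝ} (hs : 0 < s) (x : ℝ) :
    ∫⁻ y, ENNReal.ofReal (heatKernel s (y - x) ^ 2) ≤ ENNReal.ofReal (s ^ (-(1 / 2) : ℝ)) := by
  rw [← setLIntegral_univ]
  exact setLIntegral_heatKernel_sq_le_of_le hs MeasurableSet.univ
    fun y _ => heatKernel_le_rpow hs _

/-- Interpolation between the bounds `s⁻¹ a` and `s ^ (-1/2)`. -/
theorem setLIntegral_heatKernel_sq_le_measure {s x a : ℝ} (hs : 0 < s) {A : Set ℝ}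
    (hA : MeasurableSet A) (ha : 0 ≤ a) (hAa : volume A ≤ ENNReal.ofReal a) :
    ∫⁻ y in A, ENNReal.ofReal (heatKernel s (y - x) ^ 2) ≤
      ENNReal.ofReal (a ^ (1 / 2 : ℝ) * s ^ (-(3 / 4) : ℝ)) := by
  have h1 := setLIntegral_heatKernel_sq_le_of_le hs hA (x := x) fun y _ => heatKernel_le_rpow hs _
  have h2 : ∫⁻ y in A, ENNReal.ofReal (heatKernel s (y - x) ^ 2) ≤ ENNReal.ofReal (s⁻¹ * a) := by
    calc _ ≤ ∫⁻ _ in A, ENNReal.ofReal s⁻¹ := by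
          refine lintegral_mono fun y => ENNReal.ofReal_le_ofReal ?_
          calc heatKernel s (y - x) ^ 2 ≤ (s ^ (-(1 / 2) : ℝ)) ^ 2 :=
                pow_le_pow_left₀ (heatKernel_nonneg hs _) (heatKernel_le_rpow hs _) 2
            _ = s⁻¹ := by
                rw [← Real.rpow_natCast, ← Real.rpow_mul hs.le, ← Real.rpow_neg_one]; norm_num
      _ = ENNReal.ofReal s⁻¹ * volume A := by rw [setLIntegral_const]
      _ ≤ ENNReal.ofReal s⁻¹ * ENNReal.ofReal a := by gcongr
      _ = _ := by rw [← ENNReal.ofReal_mul (by positivity)]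
  set I := ∫⁻ y in A, ENNReal.ofReal (heatKernel s (y - x) ^ 2)
  have hI : I ≠ ⊤ := ne_top_of_le_ne_top ENNReal.ofReal_ne_top h1
  rw [← ENNReal.ofReal_toReal hI]
  refine ENNReal.ofReal_le_ofReal ?_
  refine (le_rpow_mul_rpow (θ := 1 / 2) ENNReal.toReal_nonneg
    (ENNReal.toReal_le_of_le_ofReal (by positivity) h1)
    (ENNReal.toReal_le_of_le_ofReal (by positivity) h2) (by norm_num) (by norm_num)).trans_eq ?_
  rw [Real.mul_rpow (by positivity) ha, ← Real.rpow_neg_one, ← Real.rpow_mul hs.le,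
    ← Real.rpow_mul hs.le, ← mul_assoc, ← Real.rpow_add hs, mul_comm]
  norm_num

/-- Outside the window, `(y - x)² / (4 s) ≥ t ^ (1 - α) / (4 t)`. -/
theorem setLIntegral_compl_window_heatKernel_sq_le {α s t x : ℝ} (hs : 0 < s) (hst : s ≤ t) :
    ∫⁻ y in (window α t x)ᶜ, ENNReal.ofReal (heatKernel s (y - x) ^ 2) ≤
      ENNReal.ofReal (s ^ (-(1 / 2) : ℝ) * Real.exp (-(t ^ (-α) / 4))) := by
  have ht : 0 < t := hs.trans_le hst
  refine setLIntegral_heatKernel_sq_le_of_le hs measurableSet_Icc.compl fun y hy => ?_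
  refine (heatKernel_le hs _).trans (mul_le_mul_of_nonneg_left (Real.exp_le_exp.2 ?_)
    (by positivity))
  have hz : t ^ ((1 - α) / 2) < |y - x| := by
    by_contra! h
    rw [abs_le] at h
    exact hy ⟨by linarith, by linarith⟩
  have hz2 : t ^ (1 - α) ≤ (y - x) ^ 2 := by
    rw [← sq_abs (y - x)]
    calc t ^ (1 - α) = (t ^ ((1 - α) / 2)) ^ 2 := by
          rw [← Real.rpow_natCast, ← Real.rpow_mul ht.le]; norm_num
      _ ≤ _ := pow_le_pow_left₀ (by positivity) hz.le 2
  have e : t ^ (-α) = t ^ (1 - α) / t := by rw [← Real.rpow_sub_one ht.ne']; ring_nf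
  rw [neg_le_neg_iff, e, div_div, mul_comm t 4]
  gcongr

theorem setLIntegral_Ioo_sub_rpow {a b θ : ℝ} (hab : a ≤ b) (hθ : θ < 1) :
    ∫⁻ s in Ioo a b, ENNReal.ofReal ((b - s) ^ (-θ)) =
      ENNReal.ofReal ((b - a) ^ (1 - θ) / (1 - θ)) := by
  have h1 : IntervalIntegrable (fun s : ℝ => s ^ (-θ)) volume (b - a) 0 :=
    intervalIntegral.intervalIntegrable_rpow' (by linarith)
  have h2 := h1.comp_sub_left b
  simp only [sub_zero, sub_sub_cancel] at h2
  rw [intervalIntegrable_iff_integrableOn_Ioo_of_le hab] at h2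
  rw [← ofReal_integral_eq_lintegral_ofReal h2]
  · congr 1
    rw [← integral_Ioc_eq_integral_Ioo, ← intervalIntegral.integral_of_le hab,
      intervalIntegral.integral_comp_sub_left (fun s => s ^ (-θ)) b, sub_self,
      integral_rpow (Or.inl (by linarith)), Real.zero_rpow (by linarith)]
    rw [show -θ + 1 = 1 - θ by ring, sub_zero]
  · refine (ae_restrict_iff' measurableSet_Ioo).2 (Eventually.of_forall fun s hs => ?_)
    exact Real.rpow_nonneg (sub_nonneg.2 hs.2.le) _

/-! ### Energy estimates for the integrands -/

theorem lintegral_spaceTime {F : ℝ × ℝ → ENNReal} (hF : Measurable F) :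
    ∫⁻ p, F p ∂spaceTime = ∫⁻ s in Ioi 0, ∫⁻ y, F (s, y) := by
  have e : spaceTime = (volume.restrict (Ioi 0)).prod volume := by
    unfold spaceTime
    rw [Measure.volume_eq_prod, ← Measure.prod_restrict, Measure.restrict_univ]
  rw [e, lintegral_prod _ hF.aemeasurable]

theorem norm_toLp_sq_le {f : ℝ × ℝ → ℝ} (hf : MemLp f 2 spaceTime) {B : ℝ} (hB : 0 ≤ B)
    (h : ∫⁻ p, ENNReal.ofReal (f p ^ 2) ∂spaceTime ≤ ENNReal.ofReal B) :
    ‖hf.toLp f‖ ^ 2 ≤ B := by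
  have e : ‖hf.toLp f‖ ^ 2 = ∫ p, f p ^ 2 ∂spaceTime := by
    rw [← real_inner_self_eq_norm_sq, L2.inner_def]
    refine integral_congr_ae ?_
    filter_upwards [hf.coeFn_toLp] with p hp
    rw [hp, real_inner_self_eq_norm_sq, Real.norm_eq_abs, sq_abs]
  rw [e, integral_eq_lintegral_of_nonneg_ae (Eventually.of_forall fun p => sq_nonneg _)
    (hf.aestronglyMeasurable.pow 2)]
  exact ENNReal.toReal_le_of_le_ofReal hB h

theorem integrand_of_mem {t s : ℝ} (hs : s ∈ Ioo 0 t) (x y : ℝ) :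
    integrand t x (s, y) = heatKernel (t - s) (y - x) :=
  indicator_of_mem (show (s, y) ∈ Ioo 0 t ×ˢ univ from ⟨hs, mem_univ _⟩) _

theorem integrand_of_notMem {t s : ℝ} (hs : s ∉ Ioo 0 t) (x y : ℝ) : integrand t x (s, y) = 0 :=
  indicator_of_notMem (fun h => hs h.1) _

theorem lintegral_integrand_sub_sq_le {t t' : ℝ} (ht : 0 ≤ t) (htt' : t ≤ t') (x x' : ℝ) :
    ∫⁻ p, ENNReal.ofReal ((integrand t' x' p - integrand t x p) ^ 2) ∂spaceTime ≤
      ENNReal.ofReal (8 * ((t' - t) ^ (1 / 4 : ℝ) + |x' - x| ^ (1 / 2 : ℝ)) * t ^ (1 / 4 : ℝ) +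
        2 * (t' - t) ^ (1 / 2 : ℝ)) := by
  have hm := measurable_integrand t x
  have hm' := measurable_integrand t' x'
  have htt : 0 ≤ t' - t := sub_nonneg.2 htt'
  rw [lintegral_spaceTime (by fun_prop)]
  set K : ℝ := (t' - t) ^ (1 / 4 : ℝ) + |x' - x| ^ (1 / 2 : ℝ)
  have hK0 : 0 ≤ K := by positivity
  -- before time `t` the two kernels are compared; between `t` and `t'` only the later one is left
  have key : ∀ s ∈ Ioi (0 : ℝ),
      ∫⁻ y, ENNReal.ofReal ((integrand t' x' (s, y) - integrand t x (s, y)) ^ 2) ≤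
        (Ioo 0 t).indicator
          (fun s => ENNReal.ofReal (2 * K) * ENNReal.ofReal ((t - s) ^ (-(3 / 4) : ℝ))) s +
        (Ico t t').indicator (fun s => ENNReal.ofReal ((t' - s) ^ (-(1 / 2) : ℝ))) s := by
    intro s hs
    rw [mem_Ioi] at hs
    rcases lt_or_ge s t with h1 | h1
    · rw [indicator_of_mem (show s ∈ Ioo 0 t from ⟨hs, h1⟩),
        indicator_of_notMem fun h => h1.not_ge h.1, add_zero, ← ENNReal.ofReal_mul (by positivity)]
      simp only [integrand_of_mem (show s ∈ Ioo 0 t from ⟨hs, h1⟩),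
        integrand_of_mem (show s ∈ Ioo 0 t' from ⟨hs, h1.trans_le htt'⟩)]
      have := lintegral_heatKernel_sub_sq_le (sub_pos.2 h1) (sub_le_sub_right htt' s) x x'
      rwa [sub_sub_sub_cancel_right] at this
    · have n1 : s ∉ Ioo 0 t := fun h => h1.not_gt h.2
      rw [indicator_of_notMem n1, zero_add]
      simp only [integrand_of_notMem n1, sub_zero]
      rcases lt_or_ge s t' with h2 | h2
      · rw [indicator_of_mem (show s ∈ Ico t t' from ⟨h1, h2⟩)]
        simp only [integrand_of_mem (show s ∈ Ioo 0 t' from ⟨hs, h2⟩)]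
        exact lintegral_heatKernel_sq_le (sub_pos.2 h2) x'
      · have n2 : s ∉ Ioo 0 t' := fun h => h2.not_gt h.2
        simp [integrand_of_notMem n2]
  calc _ ≤ ∫⁻ s in Ioi (0 : ℝ), _ := setLIntegral_mono' measurableSet_Ioi key
    _ ≤ ∫⁻ s, _ := setLIntegral_le_lintegral _ _
    _ = ENNReal.ofReal (2 * K) * ENNReal.ofReal ((t - 0) ^ (1 - 3 / 4 : ℝ) / (1 - 3 / 4)) +
        ENNReal.ofReal ((t' - t) ^ (1 - 1 / 2 : ℝ) / (1 - 1 / 2)) := by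
        rw [lintegral_add_left, lintegral_indicator measurableSet_Ioo,
          lintegral_indicator measurableSet_Ico, ← setLIntegral_congr Ioo_ae_eq_Ico,
          lintegral_const_mul, setLIntegral_Ioo_sub_rpow ht (by norm_num),
          setLIntegral_Ioo_sub_rpow htt' (by norm_num)]
        · fun_prop
        · exact Measurable.indicator (by fun_prop) measurableSet_Ioo
    _ = _ := by
        rw [← ENNReal.ofReal_mul (by positivity), ← ENNReal.ofReal_add]
        · congr 1
          rw [sub_zero]
          norm_num
          ring
        · rw [sub_zero]; positivity
        · positivity

/-- A bound `M (t - s)^(-θ)` on each time slice, with `θ < 1`, bounds the energy of the part of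
the integrand that lives over `A`. -/
theorem lintegral_indicator_integrand_sq_le {t x M θ : ℝ} (ht : 0 ≤ t) (hM : 0 ≤ M) (hθ : θ < 1)
    {A : Set ℝ} (hA : MeasurableSet A)
    (h : ∀ s ∈ Ioo 0 t, ∫⁻ y in A, ENNReal.ofReal (heatKernel (t - s) (y - x) ^ 2) ≤
      ENNReal.ofReal (M * (t - s) ^ (-θ))) :
    ∫⁻ p, ENNReal.ofReal ((univ ×ˢ A).indicator (integrand t x) p ^ 2) ∂spaceTime ≤
      ENNReal.ofReal (M * (t ^ (1 - θ) / (1 - θ))) := by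
  have hm : Measurable ((univ ×ˢ A).indicator (integrand t x)) :=
    (measurable_integrand t x).indicator (MeasurableSet.univ.prod hA)
  rw [lintegral_spaceTime (by fun_prop)]
  have key : ∀ s, ∫⁻ y, ENNReal.ofReal ((univ ×ˢ A).indicator (integrand t x) (s, y) ^ 2) ≤
      (Ioo 0 t).indicator
        (fun s => ENNReal.ofReal M * ENNReal.ofReal ((t - s) ^ (-θ))) s := by
    intro s
    by_cases hs : s ∈ Ioo 0 t
    · rw [indicator_of_mem hs, ← ENNReal.ofReal_mul hM]
      refine le_trans (le_of_eq ?_) (h s hs)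
      rw [← lintegral_indicator hA]
      refine lintegral_congr fun y => ?_
      by_cases hy : y ∈ A
      · rw [indicator_of_mem (show (s, y) ∈ univ ×ˢ A from ⟨mem_univ _, hy⟩),
          indicator_of_mem hy, integrand_of_mem hs]
      · rw [indicator_of_notMem (fun h : (s, y) ∈ univ ×ˢ A => hy h.2), indicator_of_notMem hy]
        simp
    · rw [indicator_of_notMem hs, nonpos_iff_eq_zero]
      have : ∀ y, (univ ×ˢ A).indicator (integrand t x) (s, y) = 0 := fun y =>
        indicator_apply_eq_zero.2 fun _ => integrand_of_notMem hs x y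
      simp [this]
  calc _ ≤ ∫⁻ s in Ioi (0 : ℝ), _ := lintegral_mono key
    _ ≤ ∫⁻ s, _ := setLIntegral_le_lintegral _ _
    _ = ENNReal.ofReal M * ENNReal.ofReal ((t - 0) ^ (1 - θ) / (1 - θ)) := by
        rw [lintegral_indicator measurableSet_Ioo, lintegral_const_mul _ (by fun_prop),
          setLIntegral_Ioo_sub_rpow ht hθ]
    _ = _ := by rw [← ENNReal.ofReal_mul hM, sub_zero]

/-- The two intervals between corresponding ends of the windows at `(t, x)` and `(t', x')`; they
cover the symmetric difference of the windows. -/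
def windowGap (α t x t' x' : ℝ) : Set ℝ :=
  uIcc (x - t ^ ((1 - α) / 2)) (x' - t' ^ ((1 - α) / 2)) ∪
    uIcc (x + t ^ ((1 - α) / 2)) (x' + t' ^ ((1 - α) / 2))

theorem measurableSet_windowGap (α t x t' x' : ℝ) : MeasurableSet (windowGap α t x t' x') :=
  measurableSet_uIcc.union measurableSet_uIcc

theorem rpow_sub_rpow_le {β t t' : ℝ} (h0 : 0 ≤ β) (h1 : β ≤ 1) (ht : 0 ≤ t) (htt' : t ≤ t') :
    t' ^ β - t ^ β ≤ (t' - t) ^ β := by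
  have := Real.rpow_add_le_add_rpow ht (sub_nonneg.2 htt') h0 h1
  rw [add_sub_cancel] at this
  linarith

theorem volume_windowGap_le {α t x t' x' : ℝ} (hα : α ∈ Ioo (0 : ℝ) 1) (ht : 0 ≤ t)
    (htt' : t ≤ t') : volume (windowGap α t x t' x') ≤
      ENNReal.ofReal (2 * (|x' - x| + (t' - t) ^ ((1 - α) / 2))) := by
  have hb := rpow_sub_rpow_le (β := (1 - α) / 2) (by linarith [hα.2]) (by linarith [hα.1]) ht htt'
  have hb0 : t ^ ((1 - α) / 2) ≤ t' ^ ((1 - α) / 2) :=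
    Real.rpow_le_rpow ht htt' (by linarith [hα.2])
  refine (measure_union_le _ _).trans ?_
  rw [Real.volume_interval, Real.volume_interval,
    ← ENNReal.ofReal_add (abs_nonneg _) (abs_nonneg _)]
  refine ENNReal.ofReal_le_ofReal ?_
  have h1 := le_abs_self (x' - x)
  have h2 := neg_abs_le (x' - x)
  have a1 : |x' - t' ^ ((1 - α) / 2) - (x - t ^ ((1 - α) / 2))| ≤
      |x' - x| + (t' - t) ^ ((1 - α) / 2) := by
    rw [abs_le]; constructor <;> linarith
  have a2 : |x' + t' ^ ((1 - α) / 2) - (x + t ^ ((1 - α) / 2))| ≤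
      |x' - x| + (t' - t) ^ ((1 - α) / 2) := by
    rw [abs_le]; constructor <;> linarith
  linarith

theorem mem_windowGap {α t x t' x' y : ℝ}
    (h : ¬(y ∈ window α t x ↔ y ∈ window α t' x')) : y ∈ windowGap α t x t' x' := by
  simp only [window, windowGap, mem_Icc, mem_union, mem_uIcc] at *
  by_contra! hc
  obtain ⟨⟨h1, h2⟩, h3, h4⟩ := hc
  refine h ⟨fun hy => ⟨?_, ?_⟩, fun hy => ⟨?_, ?_⟩⟩
  · by_contra! h5
    linarith [h1 hy.1]
  · by_contra! h5
    linarith [h4 h5.le]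
  · by_contra! h5
    linarith [h2 hy.1]
  · by_contra! h5
    linarith [h3 h5.le]

theorem localIntegrand_sub_sq_le (α t x t' x' : ℝ) (p : ℝ × ℝ) :
    (localIntegrand α t' x' p - localIntegrand α t x p) ^ 2 ≤
      2 * (integrand t' x' p - integrand t x p) ^ 2 +
        2 * (univ ×ˢ windowGap α t x t' x').indicator (integrand t x) p ^ 2 := by
  rw [localIntegrand_eq, localIntegrand_eq]
  have hp : ∀ A : Set ℝ, p ∈ univ ×ˢ A ↔ p.2 ∈ A := fun A => by simp [mem_prod]
  have q1 := sq_nonneg (integrand t' x' p - integrand t x p)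
  have q2 := sq_nonneg ((univ ×ˢ windowGap α t x t' x').indicator (integrand t x) p)
  by_cases h : p.2 ∈ window α t x <;> by_cases h' : p.2 ∈ window α t' x'
  · rw [indicator_of_mem ((hp _).2 h), indicator_of_mem ((hp _).2 h')]
    linarith
  · have hg : p.2 ∈ windowGap α t x t' x' := mem_windowGap (by simp [h, h'])
    rw [indicator_of_mem ((hp _).2 h), indicator_of_notMem (fun c => h' ((hp _).1 c)),
      indicator_of_mem ((hp _).2 hg)]
    nlinarith [sq_nonneg (integrand t x p)]
  · have hg : p.2 ∈ windowGap α t x t' x' := mem_windowGap (by simp [h, h'])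
    rw [indicator_of_mem ((hp _).2 h'), indicator_of_notMem (fun c => h ((hp _).1 c)),
      indicator_of_mem ((hp _).2 hg)]
    nlinarith [sq_nonneg (integrand t' x' p - 2 * integrand t x p)]
  · rw [indicator_of_notMem (fun c => h ((hp _).1 c)),
      indicator_of_notMem (fun c => h' ((hp _).1 c))]
    linarith

/-- The element of `L²` whose Wiener integral is the heat field at `(t, x)`. -/
def heatElt (t x : ℝ) : L2 := (memLp_integrand t x).toLp _

/-- The element of `L²` whose Wiener integral is the localized field at `(t, x)`. -/
def localElt (α t x : ℝ) : L2 := (memLp_localIntegrand α t x).toLp _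

theorem norm_heatElt_sub_sq_le {t t' : ℝ} (ht : 0 ≤ t) (htt' : t ≤ t') (x x' : ℝ) :
    ‖heatElt t' x' - heatElt t x‖ ^ 2 ≤
      8 * ((t' - t) ^ (1 / 4 : ℝ) + |x' - x| ^ (1 / 2 : ℝ)) * t ^ (1 / 4 : ℝ) +
        2 * (t' - t) ^ (1 / 2 : ℝ) := by
  have htt : 0 ≤ t' - t := sub_nonneg.2 htt'
  unfold heatElt
  rw [← MemLp.toLp_sub]
  exact norm_toLp_sq_le _ (by positivity) (lintegral_integrand_sub_sq_le ht htt' x x')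

theorem norm_localElt_sub_sq_le {α t t' : ℝ} (hα : α ∈ Ioo (0 : ℝ) 1) (ht : 0 ≤ t) (htt' : t ≤ t')
    (x x' : ℝ) :
    ‖localElt α t' x' - localElt α t x‖ ^ 2 ≤
      2 * (8 * ((t' - t) ^ (1 / 4 : ℝ) + |x' - x| ^ (1 / 2 : ℝ)) * t ^ (1 / 4 : ℝ) +
        2 * (t' - t) ^ (1 / 2 : ℝ)) +
      2 * ((2 * (|x' - x| + (t' - t) ^ ((1 - α) / 2))) ^ (1 / 2 : ℝ) * (4 * t ^ (1 / 4 : ℝ))) := by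
  have htt : 0 ≤ t' - t := sub_nonneg.2 htt'
  have ha : 0 ≤ 2 * (|x' - x| + (t' - t) ^ ((1 - α) / 2)) := by positivity
  have hG := measurableSet_windowGap α t x t' x'
  have h1 := lintegral_integrand_sub_sq_le ht htt' x x'
  have h2 := lintegral_indicator_integrand_sq_le (x := x) (θ := 3 / 4) ht
    (by positivity : 0 ≤ (2 * (|x' - x| + (t' - t) ^ ((1 - α) / 2))) ^ (1 / 2 : ℝ)) (by norm_num)
    hG fun s hs => setLIntegral_heatKernel_sq_le_measure (sub_pos.2 hs.2) hG ha
      (volume_windowGap_le hα ht htt')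
  have hm := measurable_integrand t x
  have hm' := measurable_integrand t' x'
  have hmi : Measurable ((univ ×ˢ windowGap α t x t' x').indicator (integrand t x)) :=
    hm.indicator (MeasurableSet.univ.prod hG)
  unfold localElt
  rw [← MemLp.toLp_sub]
  refine norm_toLp_sq_le _ (by positivity) ?_
  calc _ ≤ ∫⁻ p, (2 * ENNReal.ofReal ((integrand t' x' p - integrand t x p) ^ 2) +
        2 * ENNReal.ofReal ((univ ×ˢ windowGap α t x t' x').indicator (integrand t x) p ^ 2))
        ∂spaceTime := by
        refine lintegral_mono fun p => ?_
        refine (ENNReal.ofReal_le_ofReal (localIntegrand_sub_sq_le α t x t' x' p)).trans_eq ?_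
        rw [ENNReal.ofReal_add (by positivity) (by positivity), ENNReal.ofReal_mul (by norm_num),
          ENNReal.ofReal_mul (by norm_num), ENNReal.ofReal_ofNat]
    _ ≤ 2 * ENNReal.ofReal _ + 2 * ENNReal.ofReal _ := by
        rw [lintegral_add_left (by fun_prop), lintegral_const_mul _ (by fun_prop),
          lintegral_const_mul _ (by fun_prop)]
        exact add_le_add (mul_le_mul_right h1 2) (mul_le_mul_right h2 2)
    _ = _ := by
        rw [← ENNReal.ofReal_ofNat 2, ← ENNReal.ofReal_mul (by norm_num),
          ← ENNReal.ofReal_mul (by norm_num), ← ENNReal.ofReal_add (by positivity)]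
        · rw [show (1 - 3 / 4 : ℝ) = 1 / 4 by norm_num]
          congr 1
          ring
        · have : (0 : ℝ) ≤ 1 - 3 / 4 := by norm_num
          positivity

theorem exp_neg_le_rpow_neg {p u : ℝ} (hp : 0 < p) (hu : 0 < u) :
    Real.exp (-u) ≤ p ^ p * u ^ (-p) := by
  have h : (u / p) ^ p ≤ Real.exp u := by
    calc (u / p) ^ p ≤ Real.exp (u / p) ^ p := by
          refine Real.rpow_le_rpow (by positivity) ?_ hp.le
          linarith [Real.add_one_le_exp (u / p)]
      _ = Real.exp u := by rw [← Real.exp_mul, div_mul_cancel₀ _ hp.ne']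
  rw [Real.div_rpow hu.le hp.le] at h
  rw [Real.exp_neg, Real.rpow_neg hu.le, ← div_eq_mul_inv,
    inv_le_comm₀ (Real.exp_pos _) (by positivity), inv_div]
  exact h

/-- The energy outside the window is at most `2 t ^ (1/2) exp (-t ^ (-α) / 4)`, which is smaller
than any power of `t`; the first power suffices. -/
theorem exists_norm_heatElt_sub_localElt_sq_le {α : ℝ} (hα : 0 < α) :
    ∃ C : ℝ, 0 ≤ C ∧ ∀ t x : ℝ, 0 ≤ t → ‖heatElt t x - localElt α t x‖ ^ 2 ≤ C * t := by
  -- this power turns `exp (-t ^ (-α) / 4)` into the missing factor `t ^ (1 / 2)`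
  set p : ℝ := 1 / (2 * α) with hp
  have hp0 : 0 < p := by positivity
  refine ⟨2 * (p ^ p * 4 ^ p), by positivity, fun t x ht => ?_⟩
  have hA : MeasurableSet (window α t x)ᶜ := measurableSet_Icc.compl
  have h1 := lintegral_indicator_integrand_sq_le (x := x) (θ := 1 / 2) ht
    (Real.exp_nonneg (-(t ^ (-α) / 4))) (by norm_num) hA fun s hs => by
      rw [mul_comm]
      exact setLIntegral_compl_window_heatKernel_sq_le (sub_pos.2 hs.2) (by linarith [hs.1])
  unfold heatElt localElt
  rw [← MemLp.toLp_sub]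
  refine norm_toLp_sq_le _ (by positivity) ?_
  have e : ∀ q, (integrand t x - localIntegrand α t x) q =
      (univ ×ˢ (window α t x)ᶜ).indicator (integrand t x) q := fun q => by
    rw [Pi.sub_apply, localIntegrand_eq]
    by_cases hq : q.2 ∈ window α t x
    · rw [indicator_of_mem (show q ∈ univ ×ˢ window α t x from ⟨mem_univ _, hq⟩),
        indicator_of_notMem fun c => c.2 hq, sub_self]
    · rw [indicator_of_notMem fun c => hq c.2,
        indicator_of_mem (show q ∈ univ ×ˢ (window α t x)ᶜ from ⟨mem_univ _, hq⟩), sub_zero]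
  simp only [e]
  refine h1.trans (ENNReal.ofReal_le_ofReal ?_)
  rcases ht.eq_or_lt with rfl | ht
  · rw [Real.zero_rpow (by norm_num : (1 - 1 / 2 : ℝ) ≠ 0)]; simp
  have h2 := exp_neg_le_rpow_neg hp0 (u := t ^ (-α) / 4) (by positivity)
  have h3 : (t ^ (-α) / 4) ^ (-p) = 4 ^ p * t ^ (1 / 2 : ℝ) := by
    rw [Real.div_rpow (by positivity) (by norm_num), ← Real.rpow_mul ht.le,
      Real.rpow_neg (by norm_num : (0 : ℝ) ≤ 4), div_inv_eq_mul, mul_comm]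
    congr 2
    rw [hp]
    field_simp
  rw [h3] at h2
  have h4 : t ^ (1 / 2 : ℝ) * t ^ (1 / 2 : ℝ) = t := by
    rw [← Real.rpow_add ht]; norm_num
  calc Real.exp (-(t ^ (-α) / 4)) * (t ^ (1 - 1 / 2 : ℝ) / (1 - 1 / 2))
      = 2 * Real.exp (-(t ^ (-α) / 4)) * t ^ (1 / 2 : ℝ) := by norm_num; ring
    _ ≤ 2 * (p ^ p * (4 ^ p * t ^ (1 / 2 : ℝ))) * t ^ (1 / 2 : ℝ) := by gcongr
    _ = 2 * (p ^ p * 4 ^ p) * (t ^ (1 / 2 : ℝ) * t ^ (1 / 2 : ℝ)) := by ring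
    _ = _ := by rw [h4]

/-! ### Hölder continuity in `L²` -/

/-- Local Hölder continuity of a field in `L²` up to time `0`; the exponent `a` is that of the
squared distance. -/
def IsLocallyHolder (k : ℝ → ℝ → L2) (a : ℝ) : Prop :=
  ∀ N : ℕ, ∃ C : ℝ, 0 ≤ C ∧ ∀ t t' x x' : ℝ, 0 ≤ t → t ≤ t' → t' ≤ N → t' - t ≤ 1 →
    |x' - x| ≤ 1 → ‖k t' x' - k t x‖ ^ 2 ≤ C * max (t' - t) |x' - x| ^ a

theorem isLocallyHolder_heatElt {a : ℝ} (ha0 : 0 ≤ a) (ha : a ≤ 1 / 4) :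
    IsLocallyHolder heatElt a := by
  intro N
  refine ⟨16 * N ^ (1 / 4 : ℝ) + 2, by positivity, fun t t' x x' ht htt' hN h1 h2 => ?_⟩
  refine (norm_heatElt_sub_sq_le ht htt' x x').trans ?_
  set d := max (t' - t) |x' - x|
  have hd1 : d ≤ 1 := max_le h1 h2
  have hd0 : 0 ≤ d := (abs_nonneg _).trans (le_max_right _ _)
  have htt : 0 ≤ t' - t := sub_nonneg.2 htt'
  have key : ∀ u e : ℝ, 0 ≤ u → u ≤ d → 1 / 4 ≤ e → u ^ e ≤ d ^ a := fun u e hu hud he =>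
    (Real.rpow_le_rpow hu hud (by linarith)).trans
      (Real.rpow_le_rpow_of_exponent_ge' hd0 hd1 ha0 (by linarith))
  have k1 := key (t' - t) (1 / 4) htt (le_max_left _ _) le_rfl
  have k2 := key |x' - x| (1 / 2) (abs_nonneg _) (le_max_right _ _) (by norm_num)
  have k3 := key (t' - t) (1 / 2) htt (le_max_left _ _) (by norm_num)
  have k4 : t ^ (1 / 4 : ℝ) ≤ (N : ℝ) ^ (1 / 4 : ℝ) :=
    Real.rpow_le_rpow ht (htt'.trans hN) (by norm_num)
  calc _ ≤ 8 * (d ^ a + d ^ a) * (N : ℝ) ^ (1 / 4 : ℝ) + 2 * d ^ a := by gcongr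
    _ = _ := by ring

theorem isLocallyHolder_localElt {α : ℝ} (hα : α ∈ Ioo (0 : ℝ) 1) :
    IsLocallyHolder (localElt α) ((1 - α) / 4) := by
  have hα0 := hα.1
  have hα1 := hα.2
  intro N
  refine ⟨32 * N ^ (1 / 4 : ℝ) + 4 + 16 * N ^ (1 / 4 : ℝ), by positivity,
    fun t t' x x' ht htt' hN h1 h2 => ?_⟩
  refine (norm_localElt_sub_sq_le hα ht htt' x x').trans ?_
  set d := max (t' - t) |x' - x|
  have hd1 : d ≤ 1 := max_le h1 h2
  have hd0 : 0 ≤ d := (abs_nonneg _).trans (le_max_right _ _)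
  have htt : 0 ≤ t' - t := sub_nonneg.2 htt'
  have key : ∀ u e : ℝ, 0 ≤ u → u ≤ d → 1 / 4 ≤ e → u ^ e ≤ d ^ ((1 - α) / 4) :=
    fun u e hu hud he => (Real.rpow_le_rpow hu hud (by linarith)).trans
      (Real.rpow_le_rpow_of_exponent_ge' hd0 hd1 (by linarith) (by linarith))
  have k1 := key (t' - t) (1 / 4) htt (le_max_left _ _) le_rfl
  have k2 := key |x' - x| (1 / 2) (abs_nonneg _) (le_max_right _ _) (by norm_num)
  have k3 := key (t' - t) (1 / 2) htt (le_max_left _ _) (by norm_num)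
  have k4 : t ^ (1 / 4 : ℝ) ≤ (N : ℝ) ^ (1 / 4 : ℝ) :=
    Real.rpow_le_rpow ht (htt'.trans hN) (by norm_num)
  have k5 : (2 * (|x' - x| + (t' - t) ^ ((1 - α) / 2))) ^ (1 / 2 : ℝ) ≤ 2 * d ^ ((1 - α) / 4) := by
    have i1 : |x' - x| ≤ d ^ ((1 - α) / 2) := by
      refine (le_max_right (t' - t) _).trans ?_
      have := Real.rpow_le_rpow_of_exponent_ge' hd0 hd1 (z := (1 - α) / 2) (y := 1)
        (by linarith) (by linarith)
      rwa [Real.rpow_one] at this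
    have i2 : (t' - t) ^ ((1 - α) / 2) ≤ d ^ ((1 - α) / 2) :=
      Real.rpow_le_rpow htt (le_max_left _ _) (by linarith)
    calc _ ≤ (4 * d ^ ((1 - α) / 2)) ^ (1 / 2 : ℝ) :=
          Real.rpow_le_rpow (by positivity) (by linarith) (by norm_num)
      _ = _ := by
          rw [Real.mul_rpow (by norm_num) (by positivity), ← Real.rpow_mul hd0,
            show (4 : ℝ) = 2 ^ (2 : ℝ) by norm_num, ← Real.rpow_mul (by norm_num)]
          norm_num
          congr 1
          ring
  set D := d ^ ((1 - α) / 4)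
  have hD : 0 ≤ D := by positivity
  calc _ ≤ 2 * (8 * (D + D) * (N : ℝ) ^ (1 / 4 : ℝ) + 2 * D) +
        2 * (2 * D * (4 * (N : ℝ) ^ (1 / 4 : ℝ))) := by gcongr
    _ = _ := by ring

theorem norm_sub_sq_le_two_mul (u v : L2) : ‖u - v‖ ^ 2 ≤ 2 * ‖u‖ ^ 2 + 2 * ‖v‖ ^ 2 := by
  have h := norm_sub_le u v
  have h2 := pow_le_pow_left₀ (norm_nonneg _) h 2
  nlinarith [sq_nonneg (‖u‖ - ‖v‖)]

theorem IsLocallyHolder.sub {k l : ℝ → ℝ → L2} {a : ℝ} (hk : IsLocallyHolder k a)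
    (hl : IsLocallyHolder l a) : IsLocallyHolder (fun t x => k t x - l t x) a := by
  intro N
  obtain ⟨C, hC, h⟩ := hk N
  obtain ⟨C', hC', h'⟩ := hl N
  refine ⟨2 * C + 2 * C', by positivity, fun t t' x x' ht htt' hN h1 h2 => ?_⟩
  have i := h t t' x x' ht htt' hN h1 h2
  have i' := h' t t' x x' ht htt' hN h1 h2
  rw [sub_sub_sub_comm]
  refine (norm_sub_sq_le_two_mul _ _).trans ?_
  linarith

/-- The change of the normalizing factor `t ^ (-1/4)`, weighted by `t`, is Hölder continuous up to
`t = 0`, where the weight removes the factor. -/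
theorem sq_rpow_sub_rpow_mul_le {t t' : ℝ} (ht : 0 ≤ t) (htt' : t ≤ t') :
    (t' ^ (-(1 / 4) : ℝ) - t ^ (-(1 / 4) : ℝ)) ^ 2 * t ≤ (t' - t) ^ (1 / 2 : ℝ) := by
  have htt : 0 ≤ t' - t := sub_nonneg.2 htt'
  rcases ht.eq_or_lt with rfl | ht
  · rw [mul_zero]; positivity
  have ht' := ht.trans_le htt'
  have h1 := rpow_sub_rpow_le (β := 1 / 4) (by norm_num) (by norm_num) ht.le htt'
  set u := t ^ (1 / 4 : ℝ) with hu
  set u' := t' ^ (1 / 4 : ℝ) with hu'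
  have hu0 : 0 < u := by positivity
  have huu : u ≤ u' := Real.rpow_le_rpow ht.le htt' (by norm_num)
  have hu'0 : 0 < u' := by positivity
  have e : t = u ^ 4 := by
    rw [hu, ← Real.rpow_natCast, ← Real.rpow_mul ht.le]; norm_num
  have e2 : (t' - t) ^ (1 / 2 : ℝ) = ((t' - t) ^ (1 / 4 : ℝ)) ^ 2 := by
    rw [← Real.rpow_natCast, ← Real.rpow_mul htt]; norm_num
  rw [e2, Real.rpow_neg ht.le, Real.rpow_neg ht'.le, ← hu, ← hu']
  calc (u'⁻¹ - u⁻¹) ^ 2 * t = (u' - u) ^ 2 * (u / u') ^ 2 := by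
        rw [e]
        field_simp
        ring
    _ ≤ (u' - u) ^ 2 * 1 := by
        gcongr
        exact pow_le_one₀ (by positivity) ((div_le_one hu'0).2 huu)
    _ ≤ _ := by
        rw [mul_one]
        exact pow_le_pow_left₀ (sub_nonneg.2 huu) h1 2

theorem le_sqrt_mul_sqrt {x A B : ℝ} (hx : 0 ≤ x) (hA : x ≤ A) (hB : x ≤ B) : x ≤ √A * √B :=
  calc x = √x * √x := (Real.mul_self_sqrt hx).symm
    _ ≤ _ := by gcongr

/-- If the field is also of size `√t`, then Hölder continuity up to time `0` survives the
normalization by `t ^ (1 / 4)`, by interpolation between the two bounds. At `t = 0` the factor is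
`0`, so that the normalized field vanishes there. -/
theorem IsLocallyHolder.rpow_smul {k : ℝ → ℝ → L2} {a C₀ : ℝ} (hk : IsLocallyHolder k a)
    (ha1 : a ≤ 1) (ha0 : 0 ≤ a) (hC₀ : 0 ≤ C₀) (hk0 : ∀ t x, 0 ≤ t → ‖k t x‖ ^ 2 ≤ C₀ * t) :
    IsLocallyHolder (fun t x => t ^ (-(1 / 4) : ℝ) • k t x) (a / 2) := by
  intro N
  obtain ⟨C, hC, h⟩ := hk N
  refine ⟨2 * (√C * √(4 * C₀)) + 2 * C₀, by positivity, fun t t' x x' ht htt' hN h1 h2 => ?_⟩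
  have i := h t t' x x' ht htt' hN h1 h2
  have htt : 0 ≤ t' - t := sub_nonneg.2 htt'
  have ht' := ht.trans htt'
  set d := max (t' - t) |x' - x|
  have hd1 : d ≤ 1 := max_le h1 h2
  have hd0 : 0 ≤ d := (abs_nonneg _).trans (le_max_right _ _)
  have i2 : ‖k t' x' - k t x‖ ^ 2 ≤ 4 * C₀ * t' := by
    have j1 := hk0 t' x' ht'
    have j2 := hk0 t x ht
    have j3 : C₀ * t ≤ C₀ * t' := by gcongr
    refine (norm_sub_sq_le_two_mul _ _).trans ?_
    linarith
  have i3 := le_sqrt_mul_sqrt (sq_nonneg _) i i2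
  have e1 : √(C * d ^ a) = √C * d ^ (a / 2) := by
    rw [Real.sqrt_mul hC, Real.sqrt_eq_rpow (d ^ a), ← Real.rpow_mul hd0]
    ring_nf
  have e2 : √(4 * C₀ * t') = √(4 * C₀) * t' ^ (1 / 2 : ℝ) := by
    rw [Real.sqrt_mul (by positivity), Real.sqrt_eq_rpow t']
  rw [e1, e2] at i3
  have e3 : (t' ^ (-(1 / 4) : ℝ)) ^ 2 * t' ^ (1 / 2 : ℝ) ≤ 1 := by
    rcases ht'.eq_or_lt with h0 | h0
    · rw [← h0, Real.zero_rpow (by norm_num)]; norm_num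
    · rw [← Real.rpow_natCast, ← Real.rpow_mul ht', ← Real.rpow_add h0]; norm_num
  have i4 := sq_rpow_sub_rpow_mul_le ht htt'
  have i5 : (t' - t) ^ (1 / 2 : ℝ) ≤ d ^ (a / 2) :=
    (Real.rpow_le_rpow htt (le_max_left _ _) (by norm_num)).trans
      (Real.rpow_le_rpow_of_exponent_ge' hd0 hd1 (by linarith) (by linarith))
  have e4 : t' ^ (-(1 / 4) : ℝ) • k t' x' - t ^ (-(1 / 4) : ℝ) • k t x =
      t' ^ (-(1 / 4) : ℝ) • (k t' x' - k t x) -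
        (-(t' ^ (-(1 / 4) : ℝ) - t ^ (-(1 / 4) : ℝ))) • k t x := by
    module
  rw [e4]
  refine (norm_sub_sq_le_two_mul _ _).trans ?_
  rw [norm_smul, norm_smul, mul_pow, mul_pow, Real.norm_eq_abs, Real.norm_eq_abs, sq_abs, sq_abs,
    neg_sq]
  set b := t' ^ (-(1 / 4) : ℝ)
  set b₀ := t ^ (-(1 / 4) : ℝ)
  have m1 : b ^ 2 * ‖k t' x' - k t x‖ ^ 2 ≤ √C * √(4 * C₀) * d ^ (a / 2) := by
    calc _ ≤ b ^ 2 * (√C * d ^ (a / 2) * (√(4 * C₀) * t' ^ (1 / 2 : ℝ))) := by gcongr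
      _ = √C * √(4 * C₀) * d ^ (a / 2) * (b ^ 2 * t' ^ (1 / 2 : ℝ)) := by ring
      _ ≤ _ := mul_le_of_le_one_right (by positivity) e3
  have m2 : (b - b₀) ^ 2 * ‖k t x‖ ^ 2 ≤ C₀ * d ^ (a / 2) := by
    calc _ ≤ (b - b₀) ^ 2 * (C₀ * t) := by gcongr; exact hk0 t x ht
      _ = C₀ * ((b - b₀) ^ 2 * t) := by ring
      _ ≤ _ := by gcongr; exact i4.trans i5
  linarith

/-! ### Continuous versions and small-time asymptotics -/

section Versions

variable {Ω : Type*} [MeasurableSpace Ω] {P : Measure Ω} {W : L2 → Ω → ℝ}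

theorem IsLocallyHolder.norm_sub_sq_le_dist {k : ℝ → ℝ → L2} {a : ℝ} (hk : IsLocallyHolder k a)
    (ha : 0 ≤ a) (N : ℕ) : ∃ C : ℝ, 0 ≤ C ∧ ∀ p q : ℝ × ℝ, ‖p‖ ≤ N → ‖q‖ ≤ N → dist p q ≤ 1 →
      ‖k (max p.1 0) p.2 - k (max q.1 0) q.2‖ ^ 2 ≤ C * dist p q ^ a := by
  obtain ⟨C, hC, h⟩ := hk N
  have key : ∀ p q : ℝ × ℝ, ‖p‖ ≤ N → dist p q ≤ 1 → max q.1 0 ≤ max p.1 0 →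
      ‖k (max p.1 0) p.2 - k (max q.1 0) q.2‖ ^ 2 ≤ C * dist p q ^ a := by
    intro p q hp hd hpq
    have d1 : max p.1 0 - max q.1 0 ≤ dist p q :=
      (le_abs_self _).trans ((abs_max_sub_max_le_abs _ _ _).trans (le_max_left _ _))
    have d2 : |p.2 - q.2| ≤ dist p q := le_max_right _ _
    have hN : max p.1 0 ≤ N :=
      max_le ((le_abs_self _).trans (abs_coord_le hp).1) N.cast_nonneg
    refine (h _ _ _ _ (le_max_right _ _) hpq hN (d1.trans hd) (d2.trans hd)).trans ?_
    gcongr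
    exact max_le d1 d2
  refine ⟨C, hC, fun p q hp hq hd => ?_⟩
  rcases le_total (max q.1 0) (max p.1 0) with hpq | hpq
  · exact key p q hp hd hpq
  · rw [norm_sub_rev, dist_comm]
    exact key q p hq (dist_comm p q ▸ hd) hpq

/-- The time coordinate is cut off at `0`, which extends the process to the whole plane. -/
theorem IsWhiteNoise.hasIncrementTail (hW : IsWhiteNoise W P) {k : ℝ → ℝ → L2} {a : ℝ}
    (hk : IsLocallyHolder k a) (ha : 0 ≤ a) (m : ℕ) :
    HasIncrementTail P (fun p => W (k (max p.1 0) p.2)) m (a / 2 * m) := by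
  intro N
  obtain ⟨C, hC, h⟩ := hk.norm_sub_sq_le_dist ha N
  obtain ⟨c, hc, hc'⟩ := hW.exists_tail_bound m
  refine ⟨c * √C ^ m, by positivity, fun p q hp hq hd l hl => ?_⟩
  set u := k (max p.1 0) p.2
  set v := k (max q.1 0) q.2
  have e : P {ω | l ≤ |W u ω - W v ω|} = P {ω | l ≤ |W (u - v) ω|} := by
    refine measure_congr ?_
    filter_upwards [hW.sub_ae_eq u v] with ω hω
    exact propext (by change l ≤ _ ↔ l ≤ _; rw [hω])
  have hn : ‖u - v‖ ≤ √C * dist p q ^ (a / 2) := by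
    have := Real.sqrt_le_sqrt (h p q hp hq hd)
    rwa [Real.sqrt_sq (norm_nonneg _), Real.sqrt_mul hC, Real.sqrt_eq_rpow (dist p q ^ a),
      ← Real.rpow_mul dist_nonneg, mul_one_div] at this
  rw [e]
  refine (hc' _ l hl).trans (ENNReal.ofReal_le_ofReal ?_)
  calc c * (‖u - v‖ / l) ^ m ≤ c * ((√C * dist p q ^ (a / 2)) / l) ^ m := by gcongr
    _ = _ := by
      rw [div_pow, mul_pow, Real.rpow_mul dist_nonneg, Real.rpow_natCast]
      ring

theorem IsWhiteNoise.exists_continuous_version (hW : IsWhiteNoise W P) {k : ℝ → ℝ → L2} {a : ℝ}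
    (hk : IsLocallyHolder k a) (ha : 0 < a) :
    ∃ Y : ℝ × ℝ → Ω → ℝ, (∀ t x, 0 ≤ t → Y (t, x) =ᵐ[P] W (k t x)) ∧
      ∀ᵐ ω ∂P, Continuous fun p => Y p ω := by
  obtain ⟨m, hm⟩ := exists_nat_gt (4 / a)
  have hm2 : 2 < a / 2 * m := by
    rw [div_lt_iff₀ ha] at hm
    linarith
  have hm0 : m ≠ 0 := by
    rintro rfl
    norm_num at hm2
  obtain ⟨Y, hY, hYc⟩ := (hW.hasIncrementTail hk ha.le m).exists_continuous_version hm0 hm2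
  refine ⟨Y, fun t x ht => ?_, hYc⟩
  have := hY (t, x)
  simpa only [max_eq_left ht] using this

theorem IsWhiteNoise.exists_isContinuousVersion (hW : IsWhiteNoise W P) {k : ℝ → ℝ → L2} {a : ℝ}
    (hk : IsLocallyHolder k a) (ha : 0 < a) :
    ∃ X : ℝ → ℝ → Ω → ℝ, IsContinuousVersion P W k X := by
  obtain ⟨Y, hY, hYc⟩ := hW.exists_continuous_version hk ha
  refine ⟨fun t x => Y (t, x), fun t ht x => hY t x ht.le, ?_⟩
  filter_upwards [hYc] with ω h using h.continuousOn

/-- The difference of the two fields, divided by `t ^ (1 / 4)`, extends continuously by `0` to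
`t = 0`. -/
theorem exists_normalized_difference {α : ℝ} (hW : IsWhiteNoise W P) (hα : α ∈ Ioo (0 : ℝ) 1) :
    ∃ Y : ℝ × ℝ → Ω → ℝ, (∀ x, Y (0, x) =ᵐ[P] 0) ∧
      (∀ t x, 0 < t → (fun ω => W (heatElt t x) ω - W (localElt α t x) ω) =ᵐ[P]
        fun ω => t ^ (1 / 4 : ℝ) * Y (t, x) ω) ∧
      ∀ᵐ ω ∂P, Continuous fun p => Y p ω := by
  obtain ⟨C, hC, h⟩ := exists_norm_heatElt_sub_localElt_sq_le hα.1
  have ha : 0 < (1 - α) / 4 := by linarith [hα.2]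
  have hH := (isLocallyHolder_heatElt ha.le (by linarith [hα.1])).sub (isLocallyHolder_localElt hα)
  have hk := hH.rpow_smul (by linarith [hα.1]) ha.le hC h
  obtain ⟨Y, hY, hYc⟩ := hW.exists_continuous_version hk (half_pos ha)
  have scale : ∀ (c : ℝ) (u : L2), W (c • u) =ᵐ[P] fun ω => c * W u ω := fun c u => by
    have := hW.smul_add_smul_ae_eq c 0 u 0
    simpa using this
  refine ⟨Y, fun x => ?_, fun t x ht => ?_, hYc⟩
  · filter_upwards [hY 0 x le_rfl, scale ((0 : ℝ) ^ (-(1 / 4) : ℝ)) (heatElt 0 x - localElt α 0 x)]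
      with ω h1 h2
    rw [h1, h2, Real.zero_rpow (by norm_num), zero_mul, Pi.zero_apply]
  · filter_upwards [hY t x ht.le, scale (t ^ (-(1 / 4) : ℝ)) (heatElt t x - localElt α t x),
      hW.sub_ae_eq (heatElt t x) (localElt α t x)] with ω h1 h2 h3
    rw [h1, h2, h3, ← mul_assoc, ← Real.rpow_add ht]
    norm_num

theorem eqOn_halfPlane_of_rat {f g : ℝ × ℝ → ℝ}
    (hf : ContinuousOn f (Ioi 0 ×ˢ univ)) (hg : ContinuousOn g (Ioi 0 ×ˢ univ))
    (h : ∀ t x : ℚ, (0 : ℝ) < t → f (t, x) = g (t, x)) : EqOn f g (Ioi 0 ×ˢ univ) := by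
  have hd : DenseRange (Prod.map ((↑) : ℚ → ℝ) ((↑) : ℚ → ℝ)) :=
    Rat.isDenseEmbedding_coe_real.dense.prodMap Rat.isDenseEmbedding_coe_real.dense
  have ho : IsOpen (Ioi (0 : ℝ) ×ˢ (univ : Set ℝ)) := isOpen_Ioi.prod isOpen_univ
  have hsub := hd.open_subset_closure_inter ho
  have heq : EqOn f g (Ioi 0 ×ˢ univ ∩ range (Prod.map ((↑) : ℚ → ℝ) ((↑) : ℚ → ℝ))) := by
    rintro _ ⟨hp, ⟨t, x⟩, rfl⟩
    exact h t x hp.1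
  exact heq.of_subset_closure hf hg inter_subset_left hsub

theorem eventually_forall_abs_le {Y : ℝ × ℝ → ℝ} (hY : Continuous Y)
    (h0 : ∀ x, Y (0, x) = 0) (R : ℝ) {ε : ℝ} (hε : 0 < ε) :
    ∀ᶠ t in 𝓝 (0 : ℝ), ∀ x ∈ Icc (-R) R, |Y (t, x)| ≤ ε := by
  have ho : IsOpen {p : ℝ × ℝ | |Y p| < ε} := isOpen_lt hY.abs continuous_const
  have hsub : ({0} : Set ℝ) ×ˢ Icc (-R) R ⊆ {p : ℝ × ℝ | |Y p| < ε} := by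
    rintro ⟨t, x⟩ ⟨ht, -⟩
    rw [mem_singleton_iff] at ht
    change |Y (t, x)| < ε
    simp only at ht
    rw [ht, h0, abs_zero]
    exact hε
  obtain ⟨u, v, hu, -, hu0, hv, huv⟩ :=
    generalized_tube_lemma isCompact_singleton isCompact_Icc ho hsub
  filter_upwards [hu.mem_nhds (hu0 rfl)] with t ht x hx
  exact (huv ⟨ht, hv hx⟩ : |Y (t, x)| < ε).le

/-- With `Y` the continuous field of `exists_normalized_difference`, the difference of the two
fields is `t ^ (1 / 4) * Y (t, x)`, and `Y (t, x)` tends to `0` uniformly on `[-R, R]` because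
`Y (0, x) = 0`. -/
theorem ae_iSup_abs_sub_isLittleO (hW : IsWhiteNoise W P) {α : ℝ} (hα : α ∈ Ioo (0 : ℝ) 1) {R : ℝ}
    (hR : 0 < R) {H Hα : ℝ → ℝ → Ω → ℝ} (hH : IsHeatField P W H)
    (hHα : IsLocalHeatField P W α Hα) :
    ∀ᵐ ω ∂P, (fun t : ℝ => ⨆ x : Icc (-R) R, |H t x ω - Hα t x ω|)
      =o[𝓝[>] (0 : ℝ)] fun t : ℝ => t ^ (1 / 4 : ℝ) := by
  obtain ⟨Y, hY0, hYD, hYc⟩ := exists_normalized_difference hW hα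
  have hrat : ∀ᵐ ω ∂P, ∀ t x : ℚ, (0 : ℝ) < t →
      H t x ω - Hα t x ω = (t : ℝ) ^ (1 / 4 : ℝ) * Y (t, x) ω := by
    refine ae_all_iff.2 fun t => ae_all_iff.2 fun x => ?_
    by_cases ht : (0 : ℝ) < t
    · filter_upwards [hH.ae_eq t ht x, hHα.ae_eq t ht x, hYD t x ht] with ω h1 h2 h3 _
      rw [h1, h2]
      exact h3
    · exact Eventually.of_forall fun ω h => absurd h ht
  have hzero : ∀ᵐ ω ∂P, ∀ x : ℚ, Y (0, (x : ℝ)) ω = 0 := ae_all_iff.2 fun x => hY0 x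
  filter_upwards [hrat, hzero, hYc, hH.continuous, hHα.continuous] with ω h1 h2 h3 h4 h5
  -- the almost sure identities at rational points extend to all points by continuity
  have e0 : ∀ x, Y (0, x) ω = 0 := fun x => by
    have hc : Continuous fun x => Y (0, x) ω := h3.comp (Continuous.prodMk_right 0)
    exact congrFun (Rat.isDenseEmbedding_coe_real.dense.equalizer hc
      (continuous_const (y := (0 : ℝ))) (funext h2)) x
  have eD : EqOn (fun p : ℝ × ℝ => H p.1 p.2 ω - Hα p.1 p.2 ω)
      (fun p => p.1 ^ (1 / 4 : ℝ) * Y p ω) (Ioi 0 ×ˢ univ) := by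
    refine eqOn_halfPlane_of_rat (h4.sub h5) ?_ h1
    refine ContinuousOn.mul ?_ h3.continuousOn
    exact (continuous_fst.rpow_const fun _ => Or.inr (by norm_num)).continuousOn
  have hne : Nonempty (Icc (-R) R) := ⟨⟨0, by constructor <;> linarith⟩⟩
  refine isLittleO_iff.2 fun c hc => ?_
  filter_upwards [(eventually_forall_abs_le h3 e0 R hc).filter_mono nhdsWithin_le_nhds,
    self_mem_nhdsWithin] with t ht1 ht0
  have hp : 0 ≤ t ^ (1 / 4 : ℝ) := Real.rpow_nonneg (le_of_lt ht0) _
  rw [Real.norm_of_nonneg (Real.iSup_nonneg fun x => abs_nonneg _), Real.norm_of_nonneg hp]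
  refine ciSup_le fun x => ?_
  have := eD (show (t, (x : ℝ)) ∈ Ioi 0 ×ˢ univ from ⟨ht0, mem_univ _⟩)
  simp only at this
  rw [this, abs_mul, abs_of_nonneg hp, mul_comm]
  exact mul_le_mul_of_nonneg_right (ht1 x x.2) hp

end Versions

end

end LocalizedHeat

theorem mainTheorem5 {Ω : Type*} [MeasurableSpace Ω] (P : Measure Ω) [IsProbabilityMeasure P]
    (W : LocalizedHeat.L2 → Ω → ℝ) (hW : LocalizedHeat.IsWhiteNoise W P)
    (α : ℝ) (hα : α ∈ Ioo (0 : ℝ) 1) (R : ℝ) (hR : 0 < R) :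
    (∃ H : ℝ → ℝ → Ω → ℝ, LocalizedHeat.IsHeatField P W H) ∧
    (∃ Hα : ℝ → ℝ → Ω → ℝ, LocalizedHeat.IsLocalHeatField P W α Hα) ∧
    ∀ H Hα : ℝ → ℝ → Ω → ℝ,
      LocalizedHeat.IsHeatField P W H → LocalizedHeat.IsLocalHeatField P W α Hα →
      ∀ᵐ ω ∂P,
        (fun t : ℝ => ⨆ x : Icc (-R) R, |H t x ω - Hα t x ω|)
          =o[𝓝[>] (0 : ℝ)] fun t : ℝ => t ^ (1 / 4 : ℝ) := by
  exact ⟨hW.exists_isContinuousVersion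
      (LocalizedHeat.isLocallyHolder_heatElt (a := 1 / 4) (by norm_num) le_rfl) (by norm_num),
    hW.exists_isContinuousVersion (LocalizedHeat.isLocallyHolder_localElt hα) (by linarith [hα.2]),
    fun H Hα hH hHα => LocalizedHeat.ae_iSup_abs_sub_isLittleO hW hα hR hH hHα⟩
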